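/- **Setting.** Let $n\ge 1$, $m\ge 0$ and consider $x_{t+1}=Ax_t+w_t$, $y_t=Cx_t+v_t$ with $x_t\in\mathbb R^n$, $y_t\in\mathbb R^m$, where $x_0\sim\mathcal N(\bar x_0,X_0)$, $w_t\sim\mathcal N(0,W)$, $v_t\sim\mathcal N(0,V)$ are independent and $X_0,W,V$ are positive definite. A filter with parameters $L_t=[A_{L_t}\ B_{L_t}]\in\mathbb R^{n\times(n+m)}$ is $\hat x_0=\bar x_0$, $\hat x_{t+1}=A_{L_t}\hat x_t+B_{L_t}y_t$. For $h\ge 0$ and fixed earlier parameters $L_0,\dots,L_{h-1}$, the $h$-th subproblem is to minimize over $L=[A_{L_h}\ B_{L_h}]$ the quadratic function $$\mathcal J_h(L)=\mathbb E\Big[\sum_{t=0}^{h+1}\|x_t-\hat x_t\|^2\Big].$$ *Two-point oracle.* Given $L$ and a radius $r>0$, draw a fresh trajectory and, independently, $U$ uniform on the unit sphere $\{\|U\|_F=1\}$ of $\mathbb R^{n\times(n+m)}$; let $J_h(L\pm rU)$ be the empirical values $\sum_{t=0}^{h+1}\|x_t-\hat x_t\|^2$ of the two filters with parameters $L_0,\dots,L_{h-1},L\pm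 rU$ on that one trajectory, and return $g_h(L,r)=\frac{n(m+n)}{2r}\,[J_h(L+rU)-J_h(L-rU)]\,U$. *Update.* $L_{h,0}=[0\ 0]$ and $L_{h,i}=L_{h,i-1}-\eta_{h,i}\,g_h(L_{h,i-1},r_{h,i})$ for $i=1,2,\dots$, with independent oracle calls. *Algorithm.* For $h=0,\dots,N-1$ run $T_h$ updates on the $h$-th subproblem and use the output $L_{h,T_h}$ as the fixed $L_h$ in the later stages. One sample is one oracle call. *Constants.* Call $\mu,\psi,\kappa>0$ valid for the $h$-th subproblem with given earlier parameters if (i) $\mathcal J_h$ has quadratic growth with modulus $\mu$: for each $L$ there is a minimizer $L^*$ of $\mathcal J_h$ with $\mathcal J_h(L)-\mathcal J_h(L^*)\ge\frac\mu2\|L-L^*\|_F^2$ (if $\mathcal J_h$ is $\mu$-strongly convex, this holds with its unique minimizer); (ii) $\mathcal J_h$ is $\psi$-smooth, i.e. its gradient is $\psi$-Lipschitz; (iii) $\mathbb E\|x_{h+1}\|^2\le\kappa$. **Proposition.** 1. For every system, every sequence of filter parameters and every $N$, there are $\mu,\psi,\kappa>0$ that are valid for the subproblems $h=0,\dots,N-1$.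 2. For all $\mu,\psi,\kappa,a>0$ there are $c,K>0$ and $k\in\mathbb N$, depending only on $n,m,\mu,\psi,\kappa,a$, such that for every $\delta\in(0,\frac12]$ there is an offset $\tau\ge 0$ such that for every $\epsilon\in(0,1]$ there is an iteration number $T$ with $$T\le K\,f\,\big(\log(e+f)\big)^k,\qquad f=\epsilon^{-2}\log(\delta^{-1}),$$ that is, $T=\tilde{\mathcal O}(\epsilon^{-2}\log(\delta^{-1}))$, and the following holds for every system, every $N$, every $\rho$ and all radii $0<r_{h,i}\le\rho\,\sqrt\epsilon\; i^{-1}$, with the stepsizes $\eta_{h,i}=c/(i+\tau)\le c\,i^{-1}$: (a) (single stage) for every $h<N$ and all earlier parameters $L_0,\dots,L_{h-1}$ for which $(\mu,\psi,\kappa)$ is valid, and every $T'\ge T$, with probability at least $1-\delta$ there is a minimizer $L^*$ of $\mathcal J_h$ (the unique one, if $\mathcal J_h$ is strongly convex) with $\|L_{h,T'}-L^*\|_F\le\epsilon$; in particular $\|L_{h,T'}-L^*\|\le\epsilon$ in spectral norm; (b) (all stages) if the $N$-stage algorithm is run with $T_h=T$, then with probability at least $1-N\delta$, for every $h<N$ such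 that $(\mu,\psi,\kappa)$ is valid for the $h$-th subproblem defined by the outputs of the earlier stages, the output of stage $h$ is within $\epsilon$, in Frobenius norm, of a minimizer of that subproblem. (c) (total number of samples) whenever $N\le a\,(1+\log(\epsilon^{-1}))$, the total number $N\,T$ of oracle calls in (b) is also at most $K f(\log(e+f))^k$; so it is $\tilde{\mathcal O}(\epsilon^{-2})$ for fixed $\delta$. -/

import Mathlib

open MeasureTheory ProbabilityTheory Set

noncomputable section

namespace RHPG

/-- A linear Gaussian system `x (t+1) = A x t + w t`, `y t = C x t + v t` with state dimension `n`
and output dimension `m`, where `w t ∼ 𝒩(0, W)`, `v t ∼ 𝒩(0, V)`, `x 0 ∼ 𝒩(xbar, X0)`. -/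
structure GaussianSystem (n m : ℕ) where
  A : Matrix (Fin n) (Fin n) ℝ
  C : Matrix (Fin m) (Fin n) ℝ
  W : Matrix (Fin n) (Fin n) ℝ
  V : Matrix (Fin m) (Fin m) ℝ
  xbar : EuclideanSpace ℝ (Fin n)
  X0 : Matrix (Fin n) (Fin n) ℝ
  posDef_W : W.PosDef
  posDef_V : V.PosDef
  posDef_X0 : X0.PosDef

/-- Filter parameters `[A_L  B_L]`, an `n × (n + m)` matrix. As a Euclidean space, its norm is the
Frobenius norm (which bounds the spectral norm from above). -/
abbrev Param (n m : ℕ) : Type := EuclideanSpace ℝ (Fin n × (Fin n ⊕ Fin m))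

/-- The block `A_L` of `[A_L  B_L]`. -/
def Param.blockA {n m : ℕ} (L : Param n m) : Matrix (Fin n) (Fin n) ℝ :=
  Matrix.of fun i j => L (i, Sum.inl j)

/-- The block `B_L` of `[A_L  B_L]`. -/
def Param.blockB {n m : ℕ} (L : Param n m) : Matrix (Fin n) (Fin m) ℝ :=
  Matrix.of fun i j => L (i, Sum.inr j)

/-- The randomness of one system trajectory: `(x 0, (w t)ₜ, (v t)ₜ)`. -/
abbrev Traj (n m : ℕ) : Type :=
  EuclideanSpace ℝ (Fin n) × (ℕ → EuclideanSpace ℝ (Fin n)) × (ℕ → EuclideanSpace ℝ (Fin m))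

/-- The law of the trajectory randomness: all components independent and Gaussian. -/
def trajLaw {n m : ℕ} (S : GaussianSystem n m) : Measure (Traj n m) :=
  (multivariateGaussian S.xbar S.X0).prod
    ((Measure.infinitePi fun _ : ℕ => multivariateGaussian 0 S.W).prod
      (Measure.infinitePi fun _ : ℕ => multivariateGaussian 0 S.V))

/-- The state `x t`. -/
def state {n m : ℕ} (S : GaussianSystem n m) (ξ : Traj n m) : ℕ → EuclideanSpace ℝ (Fin n)
  | 0 => ξ.1
  | t + 1 => WithLp.toLp 2 (S.A.mulVec (state S ξ t).ofLp) + ξ.2.1 t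

/-- The measurement `y t`. -/
def output {n m : ℕ} (S : GaussianSystem n m) (ξ : Traj n m) (t : ℕ) : EuclideanSpace ℝ (Fin m) :=
  WithLp.toLp 2 (S.C.mulVec (state S ξ t).ofLp) + ξ.2.2 t

/-- The estimate `xhat t` produced by the filter `xhat (t+1) = A_{L t} xhat t + B_{L t} y t`,
`xhat 0 = xbar`, with time-varying parameters `F t = [A_{L t}  B_{L t}]`. -/
def estimate {n m : ℕ} (S : GaussianSystem n m) (F : ℕ → Param n m) (ξ : Traj n m) :
    ℕ → EuclideanSpace ℝ (Fin n)
  | 0 => S.xbar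
  | t + 1 => WithLp.toLp 2
      ((F t).blockA.mulVec (estimate S F ξ t).ofLp + (F t).blockB.mulVec (output S ξ t).ofLp)

/-- The empirical mean-square error of the `h`-th subproblem along one trajectory: the parameters
`F 0, …, F (h-1)` are kept fixed and `L` is used at time `h`. -/
def empiricalCost {n m : ℕ} (S : GaussianSystem n m) (F : ℕ → Param n m) (h : ℕ) (ξ : Traj n m)
    (L : Param n m) : ℝ :=
  ∑ t ∈ Finset.range (h + 2), ‖state S ξ t - estimate S (Function.update F h L) ξ t‖ ^ 2

/-- The objective `𝒥_h(L) = 𝔼 ∑_{t ≤ h+1} ‖x t - xhat t‖²` of the `h`-th subproblem. -/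
def cost {n m : ℕ} (S : GaussianSystem n m) (F : ℕ → Param n m) (h : ℕ) (L : Param n m) : ℝ :=
  ∫ ξ, empiricalCost S F h ξ L ∂(trajLaw S)

/-- The uniform distribution on the unit sphere `‖U‖_F = 1` of the parameter space: the normalized
surface measure. -/
def sphereLaw (n m : ℕ) : Measure (Metric.sphere (0 : Param n m) 1) :=
  ((volume : Measure (Param n m)).toSphere univ)⁻¹ • (volume : Measure (Param n m)).toSphere

/-- The randomness of one call of the two-point oracle: a trajectory and a direction `U`. -/
abbrev Sample (n m : ℕ) : Type := Traj n m × Metric.sphere (0 : Param n m) 1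

/-- The law of one oracle call; trajectory and direction are independent. -/
def sampleLaw {n m : ℕ} (S : GaussianSystem n m) : Measure (Sample n m) :=
  (trajLaw S).prod (sphereLaw n m)

/-- The two-point zeroth-order oracle with smoothing radius `r`: both perturbed filters are
simulated on the same trajectory. -/
def oracle {n m : ℕ} (S : GaussianSystem n m) (F : ℕ → Param n m) (h : ℕ) (L : Param n m) (r : ℝ)
    (s : Sample n m) : Param n m :=
  (((n : ℝ) * ((m : ℝ) + (n : ℝ))) / (2 * r) *
    (empiricalCost S F h s.1 (L + r • (s.2 : Param n m)) -
      empiricalCost S F h s.1 (L - r • (s.2 : Param n m)))) • (s.2 : Param n m)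

/-- The zeroth-order policy gradient iterates for the `h`-th subproblem, started at `[0  0]`;
iteration number `i = 1, 2, …` has smoothing radius `r i`, stepsize `η i` and a fresh oracle
sample. -/
def iterate {n m : ℕ} (S : GaussianSystem n m) (F : ℕ → Param n m) (h : ℕ) (r η : ℕ → ℝ)
    (s : ℕ → Sample n m) : ℕ → Param n m
  | 0 => 0
  | i + 1 => iterate S F h r η s i -
      η (i + 1) • oracle S F h (iterate S F h r η s i) (r (i + 1)) (s i)

/-- The whole receding-horizon algorithm, `T` iterations in every stage. `rhpg … s h` is the
sequence of filter parameters after the stages `0, …, h-1` (entries not yet computed are `0`);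
stage `h` uses the samples `s (h, ·)` and fixes the outputs of the earlier stages. -/
def rhpg {n m : ℕ} (S : GaussianSystem n m) (r : ℕ → ℕ → ℝ) (η : ℕ → ℝ) (T : ℕ)
    (s : ℕ × ℕ → Sample n m) : ℕ → (ℕ → Param n m)
  | 0 => fun _ => 0
  | h + 1 => Function.update (rhpg S r η T s h) h
      (iterate S (rhpg S r η T s h) h (r h) η (fun i => s (h, i)) T)

/-- The problem constants `(μ, ψ, κ)` are valid for the `h`-th subproblem with earlier parameters
`F 0, …, F (h-1)`:
* `𝒥_h` grows quadratically with modulus `μ` away from its minimizers (if `𝒥_h` is `μ`-strongly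
  convex this holds with its unique minimizer; it still makes sense when the Hessian of `𝒥_h` is
  singular, e.g. for `h = 0` and `n ≥ 2`, where `xhat 0 = xbar` is deterministic);
* `𝒥_h` is `ψ`-smooth;
* the second moment of the state to be predicted is at most `κ`. -/
structure HasConstants {n m : ℕ} (S : GaussianSystem n m) (F : ℕ → Param n m) (h : ℕ)
    (μ ψ κ : ℝ) : Prop where
  growth : ∀ L, ∃ Lstar, IsMinOn (cost S F h) univ Lstar ∧
    μ / 2 * ‖L - Lstar‖ ^ 2 ≤ cost S F h L - cost S F h Lstar
  differentiable : Differentiable ℝ (cost S F h)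
  smooth : ∀ L L', ‖gradient (cost S F h) L - gradient (cost S F h) L'‖ ≤ ψ * ‖L - L'‖
  moment : ∫ ξ, ‖state S ξ (h + 1)‖ ^ 2 ∂(trajLaw S) ≤ κ

/-- `L` is within `ε` of an optimal parameter of the `h`-th subproblem. -/
def NearOptimal {n m : ℕ} (S : GaussianSystem n m) (F : ℕ → Param n m) (h : ℕ) (ε : ℝ)
    (L : Param n m) : Prop :=
  ∃ Lstar, IsMinOn (cost S F h) univ Lstar ∧ ‖L - Lstar‖ ≤ ε

/-- `K · ε⁻² log(1/δ) · polylog(ε⁻² log(1/δ))`, the polylogarithm being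
`(log (e + ε⁻² log(1/δ))) ^ k`. -/
def softBound (K : ℝ) (k : ℕ) (ε δ : ℝ) : ℝ :=
  K * ((ε ^ 2)⁻¹ * Real.log δ⁻¹) *
    (Real.log (Real.exp 1 + (ε ^ 2)⁻¹ * Real.log δ⁻¹)) ^ k

instance trajLaw_isProbabilityMeasure {n m : ℕ} (S : GaussianSystem n m) :
    IsProbabilityMeasure (trajLaw S) := by
  unfold trajLaw; infer_instance

instance sphereLaw_isProbabilityMeasure {n m : ℕ} [NeZero n] :
    IsProbabilityMeasure (sphereLaw n m) := by
  have : Nonempty (Fin n × (Fin n ⊕ Fin m)) := ⟨(0, Sum.inl 0)⟩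
  have : Nontrivial (Param n m) := inferInstance
  refine ⟨?_⟩
  rw [sphereLaw, Measure.smul_apply, smul_eq_mul]
  refine ENNReal.inv_mul_cancel ?_ (measure_ne_top _ _)
  exact fun h => Measure.toSphere_ne_zero (volume : Measure (Param n m))
    (Measure.measure_univ_eq_zero.1 h)

instance sampleLaw_isProbabilityMeasure {n m : ℕ} [NeZero n] (S : GaussianSystem n m) :
    IsProbabilityMeasure (sampleLaw S) := by
  unfold sampleLaw; infer_instance

end RHPG

end

/-! Only the last summand of 𝒥_h depends on L, and the estimate at time h+1 is L applied to the
regressor Z = (x̂_h, y_h). So 𝒥_h is a constant plus the least-squares risk E‖x_{h+1} − L Z‖², a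
quadratic with Hessian 2·`gram`. For a quadratic the symmetric difference is exact: the oracle
returns −2d⟨residual, U Z⟩U with d = n(m+n), whatever the radius (`oracle_eq`). Since d·E[⟨G, U⟩²] =
‖G‖² on the sphere, this is an unbiased gradient, and the scheme is stochastic gradient descent with
stepsize (2/μ)/(i+τ).

The Lyapunov function is the excess risk V = gram(L − L₀, L − L₀) for a minimizer L₀; it ignores the
kernel of the Hessian, which may be nontrivial. Quadratic growth gives a Polyak–Łojasiewicz
inequality, hence a drift of at least 2ημV. The gradient noise is a product of Gaussian-type
factors: sub-exponential, of size proportional to 1+√V. To get a failure probability with only a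
factor log δ⁻¹, the moment of order q = ⌈log δ⁻¹⌉+2 is followed. `lintegral_pow_step_le` bounds the
conditional mean of the new V^q by (1−2qημ)V^q + C(qβ)² max(V, s/2)^q, provided qβ is small against
the exponential-moment scale; an offset τ proportional to q ensures this (`exists_schedule`).
Induction gives E V_i^q ≤ (Bq/(i+τ))^q (`lintegral_iterate_le`), and Markov's inequality gives
failure probability at most e^{-q} ≤ δ once T ≥ 2eBq/(με²) (`measure_suboptimal_le`).

In the full algorithm the samples of stage h are independent of the earlier outputs, so the
single-stage bound applies conditionally (`measure_rhpg_le`), and a union bound over the stages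
finishes the proof. -/

namespace RHPG

open scoped RealInnerProductSpace Pointwise NNReal

set_option linter.unusedSectionVars false

/-! ### Random least-squares problems with a possibly singular Hessian. -/

section Regression

/-- A random linear least-squares problem: the objective is `E ‖target - design L‖ ^ 2`. -/
structure Regression {Ω : Type*} [MeasurableSpace Ω] (P : Measure Ω) (E H : Type*)
    [NormedAddCommGroup E] [InnerProductSpace ℝ E] [MeasurableSpace E]
    [NormedAddCommGroup H] [InnerProductSpace ℝ H] [MeasurableSpace H] where
  target : Ω → H
  design : Ω → E →ₗ[ℝ] H
  size : Ω → ℝ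
  size_nonneg : ∀ ω, 0 ≤ size ω
  norm_design_le : ∀ ω M, ‖design ω M‖ ≤ size ω * ‖M‖
  measurable_target : Measurable target
  measurable_design : Measurable fun p : Ω × E => design p.1 p.2
  measurable_size : Measurable size
  memLp_target : MemLp target 2 P
  memLp_size : MemLp size 2 P

variable {Ω : Type*} [MeasurableSpace Ω] {P : Measure Ω} {E H : Type*}
  [NormedAddCommGroup E] [InnerProductSpace ℝ E] [MeasurableSpace E]
  [NormedAddCommGroup H] [InnerProductSpace ℝ H] [MeasurableSpace H] [BorelSpace H]
  [SecondCountableTopology H]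

lemma integrable_real_inner {f g : Ω → H} (hf : MemLp f 2 P) (hg : MemLp g 2 P) :
    Integrable (fun ω => ⟪f ω, g ω⟫) P := by
  have h : Integrable (fun ω => ‖f ω‖ ^ 2 + ‖g ω‖ ^ 2) P :=
    (hf.integrable_norm_pow two_ne_zero).add (hg.integrable_norm_pow two_ne_zero)
  refine h.mono' (hf.1.inner hg.1) (.of_forall fun ω => ?_)
  refine (norm_inner_le_norm _ _).trans ?_
  nlinarith [sq_nonneg (‖f ω‖ - ‖g ω‖), sq_nonneg (‖f ω‖), sq_nonneg (‖g ω‖)]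

namespace Regression

variable (R : Regression P E H)

lemma measurable_design_apply (M : E) : Measurable fun ω => R.design ω M :=
  R.measurable_design.comp measurable_prodMk_right

lemma memLp_design (M : E) : MemLp (fun ω => R.design ω M) 2 P := by
  refine (R.memLp_size.mul_const ‖M‖).mono (R.measurable_design_apply M).aestronglyMeasurable
    (.of_forall fun ω => ?_)
  rw [Real.norm_of_nonneg (mul_nonneg (R.size_nonneg ω) (norm_nonneg _))]
  exact R.norm_design_le ω M

lemma memLp_residual (L : E) : MemLp (fun ω => R.target ω - R.design ω L) 2 P :=
  R.memLp_target.sub (R.memLp_design L)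

lemma integrable_gram (M M' : E) : Integrable (fun ω => ⟪R.design ω M, R.design ω M'⟫) P :=
  integrable_real_inner (R.memLp_design M) (R.memLp_design M')

lemma integrable_corr (L M : E) :
    Integrable (fun ω => ⟪R.target ω - R.design ω L, R.design ω M⟫) P :=
  integrable_real_inner (R.memLp_residual L) (R.memLp_design M)

/-- The second-moment form `E ⟪design M, design M'⟫`. -/
noncomputable def gram : LinearMap.BilinForm ℝ E :=
  LinearMap.mk₂ ℝ (fun M M' => ∫ ω, ⟪R.design ω M, R.design ω M'⟫ ∂P)
    (fun M M' N => by
      simp only [map_add, inner_add_left]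
      exact integral_add (R.integrable_gram _ _) (R.integrable_gram _ _))
    (fun a M N => by
      simp only [map_smul, real_inner_smul_left, smul_eq_mul]
      exact integral_const_mul _ _)
    (fun M N N' => by
      simp only [map_add, inner_add_right]
      exact integral_add (R.integrable_gram _ _) (R.integrable_gram _ _))
    (fun a M N => by
      simp only [map_smul, real_inner_smul_right, smul_eq_mul]
      exact integral_const_mul _ _)

lemma gram_apply (M M' : E) : R.gram M M' = ∫ ω, ⟪R.design ω M, R.design ω M'⟫ ∂P := rfl

lemma gram_comm (M M' : E) : R.gram M M' = R.gram M' M := by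
  simp only [gram_apply, real_inner_comm]

lemma gram_self (M : E) : R.gram M M = ∫ ω, ‖R.design ω M‖ ^ 2 ∂P := by
  simp only [gram_apply, real_inner_self_eq_norm_sq]

lemma gram_self_nonneg (M : E) : 0 ≤ R.gram M M := by
  rw [gram_self]; exact integral_nonneg fun ω => sq_nonneg _

lemma gram_sq_le (M M' : E) : R.gram M M' ^ 2 ≤ R.gram M M * R.gram M' M' :=
  LinearMap.BilinForm.apply_sq_le_of_symm _ R.gram_self_nonneg ⟨fun x y => R.gram_comm x y⟩ M M'

lemma abs_gram_le (M M' : E) :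
    |R.gram M M'| ≤ Real.sqrt (R.gram M M) * Real.sqrt (R.gram M' M') := by
  rw [← Real.sqrt_mul (R.gram_self_nonneg M)]
  exact Real.abs_le_sqrt (R.gram_sq_le M M')

lemma gram_eq_zero_of_self {K : E} (hK : R.gram K K = 0) (M : E) : R.gram M K = 0 := by
  have := R.gram_sq_le M K
  rw [hK, mul_zero] at this
  exact pow_eq_zero_iff two_ne_zero |>.1 (le_antisymm this (sq_nonneg _))

/-- A null direction of the Hessian is invisible to almost every single sample, not just on average.
This is what allows singular problems. -/
lemma design_ae_eq_zero {K : E} (hK : R.gram K K = 0) : ∀ᵐ ω ∂P, R.design ω K = 0 := by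
  rw [gram_self, integral_eq_zero_iff_of_nonneg (fun _ => sq_nonneg _)
    ((R.memLp_design K).integrable_norm_pow two_ne_zero)] at hK
  filter_upwards [hK] with ω h
  simpa using h

lemma gram_add_self (M N : E) :
    R.gram (M + N) (M + N) = R.gram M M + 2 * R.gram M N + R.gram N N := by
  simp only [map_add, LinearMap.add_apply, R.gram_comm N M]; ring

lemma gram_sub_smul_self (M N : E) (a : ℝ) :
    R.gram (M - a • N) (M - a • N) = R.gram M M - 2 * a * R.gram M N + a ^ 2 * R.gram N N := by
  rw [sub_eq_add_neg, ← neg_smul, gram_add_self]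
  simp only [map_smul, LinearMap.smul_apply, smul_eq_mul]; ring

/-- The least-squares objective. -/
noncomputable def risk (L : E) : ℝ := ∫ ω, ‖R.target ω - R.design ω L‖ ^ 2 ∂P

/-- Minus half the derivative of `risk` at `L` in the direction `M`. -/
noncomputable def corr (L M : E) : ℝ := ∫ ω, ⟪R.target ω - R.design ω L, R.design ω M⟫ ∂P

lemma integrable_residual_sq (L : E) :
    Integrable (fun ω => ‖R.target ω - R.design ω L‖ ^ 2) P :=
  (R.memLp_residual L).integrable_norm_pow two_ne_zero

lemma risk_nonneg (L : E) : 0 ≤ R.risk L := integral_nonneg fun _ => sq_nonneg _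

lemma risk_add (L M : E) : R.risk (L + M) = R.risk L - 2 * R.corr L M + R.gram M M := by
  rw [gram_self, risk, risk, corr, ← integral_const_mul, ← integral_sub, ← integral_add]
  · refine integral_congr_ae (.of_forall fun ω => ?_)
    simp only [map_add, ← sub_sub]
    rw [norm_sub_sq_real]
  · exact (R.integrable_residual_sq L).sub ((R.integrable_corr L M).const_mul 2)
  · exact (R.memLp_design M).integrable_norm_pow two_ne_zero
  · exact R.integrable_residual_sq L
  · exact (R.integrable_corr L M).const_mul 2

lemma corr_smul (L M : E) (a : ℝ) : R.corr L (a • M) = a * R.corr L M := by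
  simp only [corr, map_smul, real_inner_smul_right, integral_const_mul]

lemma corr_add_right (L M N : E) : R.corr L (M + N) = R.corr L M + R.corr L N := by
  simp only [corr, map_add, inner_add_right]
  exact integral_add (R.integrable_corr _ _) (R.integrable_corr _ _)

lemma corr_add (L D M : E) : R.corr (L + D) M = R.corr L M - R.gram D M := by
  rw [corr, corr, gram_apply, ← integral_sub (R.integrable_corr _ _) (R.integrable_gram _ _)]
  refine integral_congr_ae (.of_forall fun ω => ?_)
  simp only [map_add, ← sub_sub]
  rw [inner_sub_left]

lemma corr_eq_zero {L : E} (hL : ∀ L', R.risk L ≤ R.risk L') (M : E) : R.corr L M = 0 := by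
  by_contra h0
  have key (t : ℝ) : 2 * (t * R.corr L M) ≤ t ^ 2 * R.gram M M := by
    have := hL (L + t • M)
    rw [risk_add, corr_smul] at this
    simp only [map_smul, LinearMap.smul_apply, smul_eq_mul] at this
    nlinarith
  have hq := R.gram_self_nonneg M
  -- Nearly the optimal step along M; the added 1 keeps the denominator positive when the curvature
  -- vanishes.
  have h1 := key (R.corr L M / (R.gram M M + 1))
  have h2 : 0 < R.corr L M ^ 2 := by positivity
  have h3 : 0 < R.gram M M + 1 := by linarith
  rw [div_pow, div_mul_eq_mul_div, div_mul_eq_mul_div, ← mul_div_assoc,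
    div_le_div_iff₀ h3 (by positivity)] at h1
  have h4 : 0 < R.corr L M ^ 2 * (R.gram M M + 1) * (R.gram M M + 2) := by positivity
  nlinarith

lemma risk_sub_risk {L₀ : E} (h : ∀ M, R.corr L₀ M = 0) (L : E) :
    R.risk L - R.risk L₀ = R.gram (L - L₀) (L - L₀) := by
  have := R.risk_add L₀ (L - L₀)
  rw [add_sub_cancel, h] at this
  linarith

lemma corr_eq_neg_gram {L₀ : E} (h : ∀ M, R.corr L₀ M = 0) (L M : E) :
    R.corr L M = - R.gram (L - L₀) M := by
  have := R.corr_add L₀ (L - L₀) M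
  rw [add_sub_cancel, h] at this
  linarith

section FiniteDimensional

variable [FiniteDimensional ℝ E]

/-- The vector representing `gram D` in the inner product. -/
noncomputable def gramVec (D : E) : E :=
  (InnerProductSpace.toDual ℝ E).symm (LinearMap.toContinuousLinearMap (R.gram D))

lemma inner_gramVec (D M : E) : ⟪R.gramVec D, M⟫ = R.gram D M := by
  simp [gramVec]

/-- `corr 0` as a vector. -/
noncomputable def corrVec : E :=
  (InnerProductSpace.toDual ℝ E).symm (LinearMap.toContinuousLinearMap
    (IsLinearMap.mk' (R.corr 0) ⟨R.corr_add_right 0, fun a M => R.corr_smul 0 M a⟩))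

lemma inner_corrVec (M : E) : ⟪R.corrVec, M⟫ = R.corr 0 M := by
  simp [corrVec]

/-- `gramVec` as a linear map. -/
noncomputable def gramOp : E →ₗ[ℝ] E where
  toFun := R.gramVec
  map_add' D D' := ext_inner_right ℝ fun M => by
    rw [inner_add_left, inner_gramVec, inner_gramVec, inner_gramVec, map_add, LinearMap.add_apply]
  map_smul' a D := ext_inner_right ℝ fun M => by
    rw [RingHom.id_apply, real_inner_smul_left, inner_gramVec, inner_gramVec, map_smul,
      LinearMap.smul_apply, smul_eq_mul]

lemma inner_gramOp (D M : E) : ⟪R.gramOp D, M⟫ = R.gram D M := R.inner_gramVec D M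

lemma gramOp_isSymmetric : R.gramOp.IsSymmetric := fun x y => by
  rw [inner_gramOp, real_inner_comm, inner_gramOp, gram_comm]

lemma gram_self_eq_zero_iff (K : E) : R.gram K K = 0 ↔ K ∈ LinearMap.ker R.gramOp := by
  constructor
  · intro h
    refine ext_inner_right ℝ fun M => ?_
    rw [inner_gramOp, inner_zero_left, gram_comm, R.gram_eq_zero_of_self h]
  · intro h
    rw [← inner_gramOp, LinearMap.mem_ker.1 h, inner_zero_left]

lemma corr_ker {K : E} (hK : K ∈ LinearMap.ker R.gramOp) (L : E) : R.corr L K = 0 := by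
  have := R.design_ae_eq_zero ((R.gram_self_eq_zero_iff K).2 hK)
  rw [corr, integral_eq_zero_of_ae]
  filter_upwards [this] with ω h
  simp [h]

/-- The normal equations are solvable although `gramOp` may be singular: by symmetry its range is
the orthogonal complement of its kernel, and the right-hand side vanishes on kernel directions. -/
lemma exists_corr_eq_zero : ∃ L₀ : E, ∀ M, R.corr L₀ M = 0 := by
  have h : R.corrVec ∈ LinearMap.range R.gramOp := by
    rw [← Submodule.orthogonal_orthogonal (LinearMap.range R.gramOp),
      R.gramOp_isSymmetric.orthogonal_range, Submodule.mem_orthogonal']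
    intro K hK
    rw [inner_corrVec, R.corr_ker hK]
  obtain ⟨L₀, hL₀⟩ := h
  refine ⟨L₀, fun M => ?_⟩
  have := R.corr_add 0 L₀ M
  rw [zero_add] at this
  rw [this, ← inner_corrVec, ← inner_gramOp, hL₀, sub_self]

/-- A positive semidefinite form on a finite-dimensional space grows quadratically away from its
kernel. -/
lemma exists_gram_growth : ∃ μ > (0 : ℝ), ∀ M : E, ∃ K : E, R.gram K K = 0 ∧
    μ * ‖M - K‖ ^ 2 ≤ R.gram M M := by
  set N := LinearMap.ker R.gramOp with hN
  -- On the complement of the kernel the form is definite, so compactness of the unit sphere there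
  -- gives a positive minimum. That sphere is empty when the form vanishes identically.
  obtain ⟨μ, hμ, h⟩ : ∃ μ > (0 : ℝ), ∀ u ∈ Nᗮ, μ * ‖u‖ ^ 2 ≤ R.gram u u := by
    have hcomp : IsCompact (Metric.sphere (0 : E) 1 ∩ (Nᗮ : Set E)) :=
      (isCompact_sphere 0 1).inter_right (Submodule.isClosed_orthogonal N)
    have hunit {u : E} (hu : u ∈ Nᗮ) (hu0 : u ≠ 0) :
        ‖u‖⁻¹ • u ∈ Metric.sphere (0 : E) 1 ∩ (Nᗮ : Set E) :=
      ⟨by simp [norm_smul, hu0], Nᗮ.smul_mem _ hu⟩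
    rcases (Metric.sphere (0 : E) 1 ∩ (Nᗮ : Set E)).eq_empty_or_nonempty with he | hne
    · refine ⟨1, one_pos, fun u hu => ?_⟩
      by_cases hu0 : u = 0
      · simp [hu0]
      · exact absurd (hunit hu hu0) (by simp [he])
    · have hcont : Continuous fun u : E => R.gram u u := by
        simp only [← inner_gramOp]
        exact (LinearMap.continuous_of_finiteDimensional R.gramOp).inner continuous_id
      obtain ⟨u₀, hu₀, hmin⟩ := hcomp.exists_isMinOn hne hcont.continuousOn
      refine ⟨R.gram u₀ u₀, (R.gram_self_nonneg u₀).lt_of_ne fun h0 => ?_, fun u hu => ?_⟩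
      · have h1 : u₀ ∈ N := (R.gram_self_eq_zero_iff u₀).1 h0.symm
        have h2 : u₀ = 0 := by
          have := (Submodule.mem_orthogonal N u₀).1 hu₀.2 u₀ h1
          simpa using this
        have := hu₀.1
        simp [h2] at this
      · by_cases hu0 : u = 0
        · simp [hu0]
        · have h1 := hmin (hunit hu hu0)
          simp only [mem_ofPred_eq, map_smul, LinearMap.smul_apply, smul_eq_mul] at h1
          have h2 : 0 < ‖u‖ := norm_pos_iff.2 hu0
          rw [← mul_assoc, ← mul_inv, inv_mul_eq_div, le_div_iff₀ (by positivity)] at h1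
          nlinarith
  refine ⟨μ, hμ, fun M => ?_⟩
  refine ⟨N.starProjection M, (R.gram_self_eq_zero_iff _).2 (N.starProjection_apply_mem M), ?_⟩
  have h1 := h (M - N.starProjection M) (N.sub_starProjection_mem_orthogonal M)
  have h0 := (R.gram_self_eq_zero_iff _).2 (N.starProjection_apply_mem M)
  refine h1.trans (le_of_eq ?_)
  have := R.gram_sub_smul_self M (N.starProjection M) 1
  rw [one_smul, h0, R.gram_eq_zero_of_self h0] at this
  linarith

lemma hasGradientAt_risk (L : E) :
    HasGradientAt R.risk ((2 : ℝ) • (R.gramOp L - R.corrVec)) L := by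
  have hrisk : R.risk = fun L => R.risk 0 - 2 * ⟪R.corrVec, L⟫ + ⟪R.gramOp L, L⟫ := by
    ext L
    rw [inner_corrVec, inner_gramOp, ← R.risk_add, zero_add]
  rw [hrisk, hasGradientAt_iff_hasFDerivAt]
  have hT : HasFDerivAt (fun L => R.gramOp L) (LinearMap.toContinuousLinearMap R.gramOp) L :=
    (LinearMap.toContinuousLinearMap R.gramOp).hasFDerivAt
  have h1 : HasFDerivAt (fun L : E => ⟪R.gramOp L, L⟫) _ L := hT.inner ℝ (hasFDerivAt_id L)
  have h2 : HasFDerivAt (fun L : E => ⟪R.corrVec, L⟫) _ L :=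
    (innerSL ℝ R.corrVec).hasFDerivAt
  have := ((h2.const_mul 2).const_sub (R.risk 0)).add h1
  refine this.congr_fderiv ?_
  ext M
  simp only [add_apply, neg_apply,
    smul_apply, innerSL_apply_apply, smul_eq_mul,
    InnerProductSpace.toDual_apply_apply, real_inner_smul_left, inner_sub_left,
    ContinuousLinearMap.comp_apply, ContinuousLinearMap.prod_apply, fderivInnerCLM_apply,
    LinearMap.coe_toContinuousLinearMap', ContinuousLinearMap.id_apply, inner_gramOp]
  rw [R.gram_comm M L]
  ring

end FiniteDimensional

end Regression

end Regression

/-! ### Isotropy of the uniform law on the sphere. -/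

section Sphere

variable {E : Type*} [NormedAddCommGroup E] [InnerProductSpace ℝ E]

/-- A linear isometry acting on the unit sphere. -/
def sphereIsometry (e : E ≃ₗᵢ[ℝ] E) (u : Metric.sphere (0 : E) 1) : Metric.sphere (0 : E) 1 :=
  ⟨e u, by simp⟩

lemma continuous_sphereIsometry (e : E ≃ₗᵢ[ℝ] E) : Continuous (sphereIsometry e) :=
  (e.continuous.comp continuous_subtype_val).subtype_mk _

variable [MeasurableSpace E] [BorelSpace E] [FiniteDimensional ℝ E]

/-- Surface measure is, up to a factor, the volume of the cone over a set; an isometry carries cones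
to cones and preserves volume. -/
lemma map_sphereIsometry_toSphere (e : E ≃ₗᵢ[ℝ] E) :
    (volume : Measure E).toSphere.map (sphereIsometry e) = (volume : Measure E).toSphere := by
  ext s hs
  have hm : Measurable (sphereIsometry e) := (continuous_sphereIsometry e).measurable
  rw [Measure.map_apply hm hs, Measure.toSphere_apply' _ (hm hs), Measure.toSphere_apply' _ hs]
  congr 1
  have h : (Ioo (0 : ℝ) 1 • ((↑) '' (sphereIsometry e ⁻¹' s)) : Set E) =
      e ⁻¹' (Ioo (0 : ℝ) 1 • ((↑) '' s)) := by
    ext x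
    simp only [mem_preimage, Set.mem_smul, mem_image]
    constructor
    · rintro ⟨a, ha, _, ⟨u, hu, rfl⟩, rfl⟩
      exact ⟨a, ha, _, ⟨_, hu, rfl⟩, by simp [sphereIsometry]⟩
    · rintro ⟨a, ha, _, ⟨u, hu, rfl⟩, h⟩
      refine ⟨a, ha, e.symm u, ⟨sphereIsometry e.symm u, ?_, rfl⟩, ?_⟩
      · convert! hu
        ext
        simp [sphereIsometry]
      · rw [← map_smul, h, e.symm_apply_apply]
  rw [h]
  exact (e.measurePreserving).measure_preimage_emb e.toHomeomorph.measurableEmbedding _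

/-- An isometry-invariant probability measure on the unit sphere is isotropic. -/
lemma integral_inner_sq_sphere (σ : Measure (Metric.sphere (0 : E) 1)) [IsProbabilityMeasure σ]
    (hσ : ∀ e : E ≃ₗᵢ[ℝ] E, σ.map (sphereIsometry e) = σ) (G : E) :
    (Module.finrank ℝ E : ℝ) * ∫ u, ⟪G, (u : E)⟫ ^ 2 ∂σ = ‖G‖ ^ 2 := by
  have hcont (G : E) : Continuous fun u : Metric.sphere (0 : E) 1 => ⟪G, (u : E)⟫ ^ 2 := by
    fun_prop
  have hint (G : E) : Integrable (fun u : Metric.sphere (0 : E) 1 => ⟪G, (u : E)⟫ ^ 2) σ :=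
    (hcont G).integrable_of_hasCompactSupport (HasCompactSupport.of_compactSpace _)
  have hiso (e : E ≃ₗᵢ[ℝ] E) (G : E) :
      ∫ u, ⟪e G, (u : E)⟫ ^ 2 ∂σ = ∫ u, ⟪G, (u : E)⟫ ^ 2 ∂σ := by
    conv_lhs => rw [← hσ e]
    rw [integral_map (continuous_sphereIsometry e).measurable.aemeasurable
      (hcont _).aestronglyMeasurable]
    simp [sphereIsometry]
  -- A reflection exchanges two vectors of equal norm, so the integral depends on ‖G‖ only. Summing
  -- over an orthonormal basis, where the squares add up to 1, fixes the constant.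
  have hnorm {G G' : E} (h : ‖G‖ = ‖G'‖) :
      ∫ u, ⟪G, (u : E)⟫ ^ 2 ∂σ = ∫ u, ⟪G', (u : E)⟫ ^ 2 ∂σ := by
    rw [← Submodule.reflection_sub h, hiso]
  have hsmul (k) : ∫ u, ⟪G, (u : E)⟫ ^ 2 ∂σ =
      ‖G‖ ^ 2 * ∫ u, ⟪stdOrthonormalBasis ℝ E k, (u : E)⟫ ^ 2 ∂σ := by
    rw [hnorm (G' := ‖G‖ • stdOrthonormalBasis ℝ E k)]
    · simp only [real_inner_smul_left, mul_pow, integral_const_mul]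
    · simp [norm_smul]
  have hsum : ∑ k, ∫ u, ⟪stdOrthonormalBasis ℝ E k, (u : E)⟫ ^ 2 ∂σ = 1 := by
    rw [← integral_finsetSum _ fun k _ => hint _]
    have (u : Metric.sphere (0 : E) 1) :
        ∑ k, ⟪stdOrthonormalBasis ℝ E k, (u : E)⟫ ^ 2 = 1 := by
      have := (stdOrthonormalBasis ℝ E).sum_sq_norm_inner_right (u : E)
      simpa using this
    simp [this]
  calc (Module.finrank ℝ E : ℝ) * ∫ u, ⟪G, (u : E)⟫ ^ 2 ∂σ
      = ∑ k : Fin (Module.finrank ℝ E), ∫ u, ⟪G, (u : E)⟫ ^ 2 ∂σ := by simp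
    _ = ∑ k, ‖G‖ ^ 2 * ∫ u, ⟪stdOrthonormalBasis ℝ E k, (u : E)⟫ ^ 2 ∂σ :=
        Finset.sum_congr rfl fun k _ => hsmul k
    _ = ‖G‖ ^ 2 := by rw [← Finset.mul_sum, hsum, mul_one]

lemma map_sphereIsometry_sphereLaw (n m : ℕ) (e : Param n m ≃ₗᵢ[ℝ] Param n m) :
    (sphereLaw n m).map (sphereIsometry e) = sphereLaw n m := by
  rw [sphereLaw, Measure.map_smul, map_sphereIsometry_toSphere]

end Sphere

/-! ### Exponential moments of squared Gaussians. -/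

section Gaussian

/-- From x² ≤ 2(x−m)² + 2m², the tilt uses up at most half of the Gaussian exponent, which leaves
the density of variance 2v. The normalization costs √2 and the mean costs exp(1/4), together less
than 2. -/
lemma exp_mul_sq_mul_gaussianPDFReal_le {m l : ℝ} {v : ℝ≥0} (hl : 0 ≤ l)
    (h : 8 * l * (m ^ 2 + v) ≤ 1) (x : ℝ) :
    Real.exp (l * x ^ 2) * gaussianPDFReal m v x ≤ 2 * gaussianPDFReal m (2 * v) x := by
  rcases eq_or_ne v 0 with rfl | hv
  · simp
  have hv : 0 < (v : ℝ) := by positivity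
  have hlv : 8 * l * v ≤ 1 := by nlinarith [mul_nonneg hl (sq_nonneg m)]
  have hlm : 8 * l * m ^ 2 ≤ 1 := by nlinarith [mul_nonneg hl hv.le]
  simp only [gaussianPDFReal, NNReal.coe_mul, NNReal.coe_ofNat]
  have hsq : (Real.sqrt (2 * Real.pi * v))⁻¹ =
      Real.sqrt 2 * (Real.sqrt (2 * Real.pi * (2 * v)))⁻¹ := by
    rw [show 2 * Real.pi * (2 * (v : ℝ)) = 2 * (2 * Real.pi * v) by ring,
      Real.sqrt_mul (by norm_num) (2 * Real.pi * v), mul_inv, ← mul_assoc,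
      mul_inv_cancel₀ (by positivity), one_mul]
  have hexp : Real.exp (l * x ^ 2) * Real.exp (-(x - m) ^ 2 / (2 * v)) ≤
      Real.exp (1 / 4) * Real.exp (-(x - m) ^ 2 / (2 * (2 * v))) := by
    rw [← Real.exp_add, ← Real.exp_add, Real.exp_le_exp]
    have h1 : -(x - m) ^ 2 / (2 * v) = 2 * (-(x - m) ^ 2 / (2 * (2 * v))) := by
      field_simp
    have h2 : 2 * l * (x - m) ^ 2 ≤ (x - m) ^ 2 / (2 * (2 * v)) := by
      rw [le_div_iff₀ (by positivity)]
      nlinarith [mul_le_mul_of_nonneg_right hlv (sq_nonneg (x - m))]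
    have h3 : l * x ^ 2 ≤ 2 * l * (x - m) ^ 2 + 2 * l * m ^ 2 := by
      nlinarith [mul_nonneg hl (sq_nonneg (x - 2 * m))]
    rw [h1, neg_div]
    linarith
  have hc : Real.sqrt 2 * Real.exp (1 / 4) ≤ 2 := by
    refine le_of_sq_le_sq ?_ (by norm_num)
    rw [mul_pow, Real.sq_sqrt (by norm_num), ← Real.exp_nat_mul]
    have h4 : Real.exp ((2 : ℕ) * (1 / 4)) ≤ 2 := by
      refine le_of_sq_le_sq ?_ (by norm_num)
      rw [← Real.exp_nat_mul]
      norm_num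
      exact Real.exp_one_lt_d9.le.trans (by norm_num)
    linarith
  calc _ = Real.sqrt 2 * (Real.sqrt (2 * Real.pi * (2 * v)))⁻¹ *
        (Real.exp (l * x ^ 2) * Real.exp (-(x - m) ^ 2 / (2 * v))) := by rw [hsq]; ring
    _ ≤ Real.sqrt 2 * (Real.sqrt (2 * Real.pi * (2 * v)))⁻¹ *
        (Real.exp (1 / 4) * Real.exp (-(x - m) ^ 2 / (2 * (2 * v)))) := by gcongr
    _ = (Real.sqrt 2 * Real.exp (1 / 4)) * ((Real.sqrt (2 * Real.pi * (2 * v)))⁻¹ *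
        Real.exp (-(x - m) ^ 2 / (2 * (2 * v)))) := by ring
    _ ≤ _ := by gcongr

lemma lintegral_exp_mul_sq_gaussianReal_le {m l : ℝ} {v : ℝ≥0} (hl : 0 ≤ l)
    (h : 8 * l * (m ^ 2 + v) ≤ 1) :
    ∫⁻ x, ENNReal.ofReal (Real.exp (l * x ^ 2)) ∂gaussianReal m v ≤ 2 := by
  rcases eq_or_ne v 0 with rfl | hv
  · rw [gaussianReal_zero_var, lintegral_dirac' _ (by fun_prop)]
    rw [← ENNReal.ofReal_ofNat]
    refine ENNReal.ofReal_le_ofReal ?_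
    have h1 : l * m ^ 2 ≤ Real.log 2 := by
      have := Real.log_two_gt_d9
      simp only [NNReal.coe_zero, add_zero] at h
      nlinarith
    calc Real.exp (l * m ^ 2) ≤ Real.exp (Real.log 2) := Real.exp_le_exp.2 h1
      _ = 2 := Real.exp_log (by norm_num)
  · rw [gaussianReal_of_var_ne_zero _ hv,
      lintegral_withDensity_eq_lintegral_mul _ (by fun_prop) (by fun_prop)]
    calc _ ≤ ∫⁻ x, ENNReal.ofReal 2 * ENNReal.ofReal (gaussianPDFReal m (2 * v) x) := by
          refine lintegral_mono fun x => ?_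
          simp only [Pi.mul_apply, gaussianPDF]
          rw [← ENNReal.ofReal_mul (gaussianPDFReal_nonneg _ _ _),
            ← ENNReal.ofReal_mul (by norm_num), mul_comm]
          exact ENNReal.ofReal_le_ofReal (exp_mul_sq_mul_gaussianPDFReal_le hl h x)
      _ = 2 := by
          rw [lintegral_const_mul _ (by fun_prop),
            lintegral_gaussianPDFReal_eq_one _ (by simpa using hv)]
          simp

lemma lintegral_exp_mul_sq_le {Ω : Type*} [MeasurableSpace Ω] {P : Measure Ω} {Y : Ω → ℝ}
    (hY : HasGaussianLaw Y P) {l : ℝ} (hl : 0 ≤ l) (h : 8 * l * ∫ ω, Y ω ^ 2 ∂P ≤ 1) :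
    ∫⁻ ω, ENNReal.ofReal (Real.exp (l * Y ω ^ 2)) ∂P ≤ 2 := by
  have := hY.isProbabilityMeasure
  have h1 : ∫⁻ ω, ENNReal.ofReal (Real.exp (l * Y ω ^ 2)) ∂P =
      ∫⁻ x, ENNReal.ofReal (Real.exp (l * x ^ 2)) ∂(P.map Y) :=
    (lintegral_map' (f := fun x => ENNReal.ofReal (Real.exp (l * x ^ 2))) (by fun_prop)
      hY.aemeasurable).symm
  rw [h1, hY.map_eq_gaussianReal]
  refine lintegral_exp_mul_sq_gaussianReal_le hl ?_
  rw [Real.coe_toNNReal _ (variance_nonneg _ _), variance_eq_sub hY.memLp_two]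
  simpa using h

/-! ### Gaussianity of states, outputs and estimates. -/

variable {n m : ℕ}

/-- The noise components that the first `T` steps depend on. -/
abbrev NoiseSpace (n m T : ℕ) : Type :=
  EuclideanSpace ℝ (Fin n) × (Finset.range T → EuclideanSpace ℝ (Fin n)) ×
    (Finset.range T → EuclideanSpace ℝ (Fin m))

/-- Restriction of the noise to the first `T` steps. -/
def noiseProj (T : ℕ) (ξ : Traj n m) : NoiseSpace n m T :=
  (ξ.1, (Finset.range T).restrict ξ.2.1, (Finset.range T).restrict ξ.2.2)

lemma measurable_noiseProj (T : ℕ) : Measurable (noiseProj T : Traj n m → _) := by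
  unfold noiseProj; fun_prop

lemma isGaussian_map_restrict_infinitePi {E : Type*} [NormedAddCommGroup E] [InnerProductSpace ℝ E]
    [FiniteDimensional ℝ E] [MeasurableSpace E] [BorelSpace E] (ν : Measure E) [IsGaussian ν]
    (I : Finset ℕ) : IsGaussian ((Measure.infinitePi fun _ : ℕ => ν).map I.restrict) := by
  have hind : iIndepFun (fun (i : I) (ω : ℕ → E) => ω i) (Measure.infinitePi fun _ : ℕ => ν) :=
    (iIndepFun_infinitePi (P := fun _ : ℕ => ν) (X := fun _ x => x)
      (fun _ => measurable_id)).precomp Subtype.val_injective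
  have hg (i : I) : HasGaussianLaw (fun ω : ℕ → E => ω i) (Measure.infinitePi fun _ : ℕ => ν) :=
    ⟨by rw [Measure.infinitePi_map_eval (fun _ : ℕ => ν)]; infer_instance⟩
  exact (iIndepFun.hasGaussianLaw hg hind).isGaussian_map

lemma isGaussian_prod {E F : Type*} [NormedAddCommGroup E] [NormedSpace ℝ E] [MeasurableSpace E]
    [BorelSpace E] [SecondCountableTopology E] [NormedAddCommGroup F] [NormedSpace ℝ F]
    [MeasurableSpace F] [BorelSpace F] [SecondCountableTopology F] (μ : Measure E) (ν : Measure F)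
    [IsGaussian μ] [IsGaussian ν] : IsGaussian (μ.prod ν) :=
  inferInstance

lemma isGaussian_map_noiseProj (S : GaussianSystem n m) (T : ℕ) :
    IsGaussian ((trajLaw S).map (noiseProj T)) := by
  have := isGaussian_map_restrict_infinitePi (multivariateGaussian 0 S.W) (Finset.range T)
  have := isGaussian_map_restrict_infinitePi (multivariateGaussian 0 S.V) (Finset.range T)
  have h : (noiseProj T : Traj n m → _) =
      Prod.map id (Prod.map (Finset.range T).restrict (Finset.range T).restrict) := rfl
  rw [h, trajLaw, ← Measure.map_prod_map _ _ measurable_id (by fun_prop),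
    ← Measure.map_prod_map _ _ (by fun_prop) (by fun_prop), Measure.map_id]
  have h2 := isGaussian_prod ((Measure.infinitePi fun _ : ℕ => multivariateGaussian 0 S.W).map
    (Finset.range T).restrict) ((Measure.infinitePi fun _ : ℕ => multivariateGaussian 0 S.V).map
    (Finset.range T).restrict)
  exact isGaussian_prod _ _

/-- `Y` is an affine function of the noise of the first `T` steps. -/
def IsNoiseAffine (T : ℕ) (Y : Traj n m → ℝ) : Prop :=
  ∃ (l : NoiseSpace n m T →L[ℝ] ℝ) (c : ℝ), ∀ ξ, Y ξ = l (noiseProj T ξ) + c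

namespace IsNoiseAffine

variable {T : ℕ} {Y Y' : Traj n m → ℝ}

lemma const (c : ℝ) : IsNoiseAffine T (fun _ : Traj n m => c) := ⟨0, c, by simp⟩

lemma add (h : IsNoiseAffine T Y) (h' : IsNoiseAffine T Y') :
    IsNoiseAffine T (fun ξ => Y ξ + Y' ξ) := by
  obtain ⟨l, c, h⟩ := h
  obtain ⟨l', c', h'⟩ := h'
  exact ⟨l + l', c + c', fun ξ => by simp only [h, h', add_apply]; ring⟩

lemma const_mul (a : ℝ) (h : IsNoiseAffine T Y) : IsNoiseAffine T (fun ξ => a * Y ξ) := by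
  obtain ⟨l, c, h⟩ := h
  exact ⟨a • l, a * c, fun ξ => by simp only [h, smul_apply, smul_eq_mul]; ring⟩

lemma sum {ι : Type*} (s : Finset ι) {Y : ι → Traj n m → ℝ}
    (h : ∀ i ∈ s, IsNoiseAffine T (Y i)) : IsNoiseAffine T (fun ξ => ∑ i ∈ s, Y i ξ) := by
  classical
  induction s using Finset.induction_on with
  | empty => simpa using const 0
  | insert i s hi ih =>
    simp only [Finset.sum_insert hi]
    exact (h i (by simp)).add (ih fun j hj => h j (by simp [hj]))

/-- The trajectory space is an infinite product without a norm, so Gaussianity is transported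
through the finite-dimensional projection `noiseProj`. -/
lemma hasGaussianLaw (S : GaussianSystem n m) (h : IsNoiseAffine T Y) :
    HasGaussianLaw Y (trajLaw S) := by
  obtain ⟨l, c, h⟩ := h
  have := isGaussian_map_noiseProj S T
  obtain rfl : Y = fun ξ => l (noiseProj T ξ) + c := funext h
  have : IsGaussian ((((trajLaw S).map (noiseProj T)).map l).map (fun x => x + c)) := inferInstance
  rw [Measure.map_map (by fun_prop) (by fun_prop),
    Measure.map_map (by fun_prop) (measurable_noiseProj T)] at this
  exact ⟨this⟩

end IsNoiseAffine

variable (S : GaussianSystem n m)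

lemma isNoiseAffine_state {T t : ℕ} (ht : t ≤ T) (i : Fin n) :
    IsNoiseAffine T (fun ξ => state S ξ t i) := by
  induction t generalizing i with
  | zero =>
    exact ⟨(EuclideanSpace.proj i).comp (ContinuousLinearMap.fst ℝ _ _), 0, fun ξ => by
      simp [state, noiseProj]⟩
  | succ t ih =>
    have h : IsNoiseAffine T (fun ξ : Traj n m => ξ.2.1 t i) :=
      ⟨(EuclideanSpace.proj i).comp ((ContinuousLinearMap.proj
        (⟨t, Finset.mem_range.2 (by omega)⟩ : Finset.range T)).comp
        ((ContinuousLinearMap.fst ℝ _ _).comp (ContinuousLinearMap.snd ℝ _ _))), 0, fun ξ => by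
        simp [noiseProj]⟩
    refine (IsNoiseAffine.sum Finset.univ fun j _ =>
      (ih (by omega) j).const_mul (S.A i j)).add h

lemma isNoiseAffine_output {T t : ℕ} (ht : t < T) (i : Fin m) :
    IsNoiseAffine T (fun ξ => output S ξ t i) := by
  have h : IsNoiseAffine T (fun ξ : Traj n m => ξ.2.2 t i) :=
    ⟨(EuclideanSpace.proj i).comp ((ContinuousLinearMap.proj
      (⟨t, Finset.mem_range.2 ht⟩ : Finset.range T)).comp
      ((ContinuousLinearMap.snd ℝ _ _).comp (ContinuousLinearMap.snd ℝ _ _))), 0, fun ξ => by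
      simp [noiseProj]⟩
  exact (IsNoiseAffine.sum Finset.univ fun j _ =>
    (isNoiseAffine_state S ht.le j).const_mul (S.C i j)).add h

lemma isNoiseAffine_estimate (F : ℕ → Param n m) {T t : ℕ} (ht : t ≤ T) (i : Fin n) :
    IsNoiseAffine T (fun ξ => estimate S F ξ t i) := by
  induction t generalizing i with
  | zero => exact IsNoiseAffine.const (S.xbar i)
  | succ t ih =>
    exact (IsNoiseAffine.sum Finset.univ fun j _ =>
      (ih (by omega) j).const_mul ((F t).blockA i j)).add
      (IsNoiseAffine.sum Finset.univ fun j _ =>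
        (isNoiseAffine_output S (by omega) j).const_mul ((F t).blockB i j))

end Gaussian

/-! ### Scalar inequalities for powers of the Lyapunov function. -/

section Scalar

/-- Second-order Taylor bound, by multiplying with b in the induction; the crude factor (p+2)²
leaves enough room for that step to close. -/
lemma pow_le_taylor {a b M : ℝ} (ha : 0 ≤ a) (hb : 0 ≤ b) (haM : a ≤ M) (hbM : b ≤ M) (p : ℕ) :
    b ^ (p + 2) ≤ a ^ (p + 2) + (p + 2 : ℝ) * a ^ (p + 1) * (b - a) +
      (p + 2 : ℝ) ^ 2 * (b - a) ^ 2 * M ^ p := by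
  have hM : 0 ≤ M := ha.trans haM
  induction p with
  | zero =>
    simp only [pow_zero, Nat.cast_zero, zero_add, pow_one, mul_one]
    nlinarith [sq_nonneg (b - a)]
  | succ p ih =>
    have h1 := mul_le_mul_of_nonneg_left ih hb
    have h2 : a ^ (p + 1) ≤ M ^ (p + 1) := pow_le_pow_left₀ ha haM _
    have h3 : b * M ^ p ≤ M ^ (p + 1) := by
      rw [pow_succ, mul_comm]; exact mul_le_mul_of_nonneg_left hbM (pow_nonneg hM _)
    have hp : (0 : ℝ) ≤ p := Nat.cast_nonneg p
    have h4 : (b - a) ^ 2 * ((p + 2 : ℝ) * a ^ (p + 1) + (p + 2 : ℝ) ^ 2 * (b * M ^ p)) ≤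
        (b - a) ^ 2 * ((p + 1 + 2 : ℝ) ^ 2 * M ^ (p + 1)) := by
      refine mul_le_mul_of_nonneg_left ?_ (sq_nonneg _)
      have h5 : (p + 2 : ℝ) * a ^ (p + 1) ≤ (p + 2 : ℝ) * M ^ (p + 1) := by gcongr
      have h6 : (p + 2 : ℝ) ^ 2 * (b * M ^ p) ≤ (p + 2 : ℝ) ^ 2 * M ^ (p + 1) := by gcongr
      nlinarith [pow_nonneg hM (p + 1)]
    push_cast
    calc b ^ (p + 1 + 2) = b * b ^ (p + 2) := by ring
      _ ≤ _ := h1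
      _ = a ^ (p + 1 + 2) + (p + 1 + 2 : ℝ) * a ^ (p + 1 + 1) * (b - a) +
          (b - a) ^ 2 * ((p + 2 : ℝ) * a ^ (p + 1) + (p + 2 : ℝ) ^ 2 * (b * M ^ p)) := by ring
      _ ≤ _ := by linarith

/-- Here y is the step length relative to √w, so the new value is at most w(1+y)². In the constant
5, the Taylor remainder accounts for 4 and the part η²Q of the linear term for 1; powers of 1+y go
into the exponential. -/
lemma pow_step_le {v w y η X Q : ℝ} (p : ℕ) (hv : 0 ≤ v) (hvw : v ≤ w) (hy : 0 ≤ y)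
    (hX : |η * X| ≤ w * y) (hQ0 : 0 ≤ Q) (hQ : η ^ 2 * Q ≤ w * y ^ 2)
    (hpos : 0 ≤ v - 2 * η * X + η ^ 2 * Q) :
    (v - 2 * η * X + η ^ 2 * Q) ^ (p + 2) ≤ v ^ (p + 2) - 2 * (p + 2) * η * v ^ (p + 1) * X +
      5 * (p + 2) ^ 2 * w ^ (p + 2) * (y ^ 2 * Real.exp (2 * (p + 2) * y)) := by
  have hw : 0 ≤ w := hv.trans hvw
  have hwy : 0 ≤ w * y := mul_nonneg hw hy
  have hp : (0 : ℝ) ≤ p := Nat.cast_nonneg p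
  have hX' := abs_le.1 hX
  have hQ0' : 0 ≤ η ^ 2 * Q := mul_nonneg (sq_nonneg _) hQ0
  have hM : w * (1 + y) ^ 2 = w + 2 * (w * y) + w * y ^ 2 := by ring
  have hwy2 : 0 ≤ w * y ^ 2 := mul_nonneg hw (sq_nonneg y)
  have htaylor := pow_le_taylor hv hpos (M := w * (1 + y) ^ 2) (by rw [hM]; linarith)
    (by rw [hM]; linarith) p
  have hu : (v - 2 * η * X + η ^ 2 * Q - v) ^ 2 ≤ 4 * w ^ 2 * y ^ 2 * (1 + y) ^ 2 := by
    have : 4 * w ^ 2 * y ^ 2 * (1 + y) ^ 2 = (2 * (w * y) * (1 + y)) ^ 2 := by ring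
    rw [this]
    refine sq_le_sq' ?_ ?_ <;> nlinarith
  have hexp (k : ℕ) (hk : k ≤ 2 * (p + 2)) : (1 + y) ^ k ≤ Real.exp (2 * (p + 2) * y) := by
    calc (1 + y) ^ k ≤ (1 + y) ^ (2 * (p + 2)) := pow_le_pow_right₀ (by linarith) hk
      _ ≤ Real.exp y ^ (2 * (p + 2)) :=
        pow_le_pow_left₀ (by linarith) (by linarith [Real.add_one_le_exp y]) _
      _ = _ := by rw [← Real.exp_nat_mul]; push_cast; ring_nf
  have h1 : (p + 2 : ℝ) ^ 2 * (v - 2 * η * X + η ^ 2 * Q - v) ^ 2 * (w * (1 + y) ^ 2) ^ p ≤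
      4 * (p + 2) ^ 2 * w ^ (p + 2) * (y ^ 2 * Real.exp (2 * (p + 2) * y)) := by
    calc _ ≤ (p + 2 : ℝ) ^ 2 * (4 * w ^ 2 * y ^ 2 * (1 + y) ^ 2) * (w * (1 + y) ^ 2) ^ p := by
          gcongr
      _ = 4 * (p + 2) ^ 2 * w ^ (p + 2) * (y ^ 2 * (1 + y) ^ (2 * p + 2)) := by
          rw [mul_pow, ← pow_mul]; ring
      _ ≤ _ := by gcongr; exact hexp _ (by omega)
  have h2 : (p + 2 : ℝ) * v ^ (p + 1) * (η ^ 2 * Q) ≤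
      (p + 2) ^ 2 * w ^ (p + 2) * (y ^ 2 * Real.exp (2 * (p + 2) * y)) := by
    calc (p + 2 : ℝ) * v ^ (p + 1) * (η ^ 2 * Q) ≤ (p + 2 : ℝ) * w ^ (p + 1) * (w * y ^ 2) := by
          gcongr
      _ = (p + 2 : ℝ) * w ^ (p + 2) * (y ^ 2 * (1 + y) ^ 0) := by ring
      _ ≤ (p + 2) ^ 2 * w ^ (p + 2) * (y ^ 2 * Real.exp (2 * (p + 2) * y)) := by
          gcongr
          · nlinarith
          · exact hexp 0 (by omega)
  nlinarith

/-- One half of the exponent 2lξ absorbs exp(ky), the other half absorbs y² through t² ≤ 2eᵗ. -/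
lemma sq_mul_exp_le {y c ξ l k : ℝ} (hξ : 0 ≤ ξ) (hl : 0 < l) (hy : y = c * ξ)
    (hk : k * c ≤ l) :
    y ^ 2 * Real.exp (k * y) ≤ 2 * (c / l) ^ 2 * Real.exp (2 * l * ξ) := by
  have h1 : (l * ξ) ^ 2 ≤ 2 * Real.exp (l * ξ) := by
    have := Real.quadratic_le_exp_of_nonneg (mul_nonneg hl.le hξ)
    have := mul_nonneg hl.le hξ
    linarith
  have h2 : Real.exp (k * y) ≤ Real.exp (l * ξ) := by
    rw [hy, ← mul_assoc]
    exact Real.exp_le_exp.2 (mul_le_mul_of_nonneg_right hk hξ)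
  calc y ^ 2 * Real.exp (k * y) = (c / l) ^ 2 * (l * ξ) ^ 2 * Real.exp (k * y) := by
        rw [hy]; field_simp
    _ ≤ (c / l) ^ 2 * (2 * Real.exp (l * ξ)) * Real.exp (l * ξ) := by gcongr
    _ = 2 * (c / l) ^ 2 * (Real.exp (l * ξ) * Real.exp (l * ξ)) := by ring
    _ = _ := by rw [← Real.exp_add]; ring_nf

end Scalar

/-! ### Moment inequality for one stochastic gradient step. -/

section OneStep

variable {Ω : Type*} [MeasurableSpace Ω] {P : Measure Ω} {E H : Type*}
  [NormedAddCommGroup E] [InnerProductSpace ℝ E] [MeasurableSpace E] [BorelSpace E]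
  [FiniteDimensional ℝ E]
  [NormedAddCommGroup H] [InnerProductSpace ℝ H] [MeasurableSpace H] [BorelSpace H]
  [SecondCountableTopology H]

namespace Regression

variable (R : Regression P E H)

/-- The regression problem has minimizer `L₀` and constants `μ`, `ψ`, `κ`. -/
structure Controlled (μ ψ κ : ℝ) (L₀ : E) : Prop where
  corr_eq_zero : ∀ M, R.corr L₀ M = 0
  growth : ∀ M, ∃ K, R.gram K K = 0 ∧ μ / 2 * ‖M - K‖ ^ 2 ≤ R.gram M M
  smooth : ∀ M, R.gram M M ≤ ψ / 2 * ‖M‖ ^ 2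
  norm_sq_le : ‖L₀‖ ^ 2 ≤ 2 * κ / μ

/-- The two-point gradient estimate in the direction `z.2`, for the sample `z.1`. -/
noncomputable def gradEstimate (L : E) (z : Ω × Metric.sphere (0 : E) 1) : E :=
  (-2 * (Module.finrank ℝ E : ℝ) * ⟪R.target z.1 - R.design z.1 L, R.design z.1 z.2⟫) • (z.2 : E)

/-- The sub-exponential variable that controls the gradient estimate. -/
noncomputable def envelope (ω : Ω) : ℝ := R.size ω ^ 2 + ‖R.target ω‖ ^ 2

lemma envelope_nonneg (ω : Ω) : 0 ≤ R.envelope ω := by unfold envelope; positivity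

lemma measurable_envelope : Measurable R.envelope :=
  (R.measurable_size.pow_const 2).add (R.measurable_target.norm.pow_const 2)

/-- The factor between the gradient estimate and the envelope. -/
noncomputable def noiseConst (d : ℕ) (μ ψ κ : ℝ) : ℝ :=
  Real.sqrt (ψ / 2) * (2 * d) * (1 + Real.sqrt (2 * κ / μ) + Real.sqrt (2 / μ))

lemma noiseConst_nonneg (d : ℕ) (μ ψ κ : ℝ) : 0 ≤ noiseConst d μ ψ κ := by
  unfold noiseConst; positivity

variable {R} {μ ψ κ : ℝ} {L₀ : E}

namespace Controlled

variable (hR : R.Controlled μ ψ κ L₀)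
include hR

lemma exists_norm_le (hμ : 0 < μ) (D : E) :
    ∃ K, R.gram K K = 0 ∧ ‖D - K‖ ≤ Real.sqrt (2 / μ) * Real.sqrt (R.gram D D) := by
  obtain ⟨K, hK, h⟩ := hR.growth D
  refine ⟨K, hK, ?_⟩
  rw [← Real.sqrt_mul (by positivity)]
  refine Real.le_sqrt_of_sq_le ?_
  rw [div_mul_eq_mul_div, le_div_iff₀ hμ]
  linarith

/-- The Polyak–Łojasiewicz inequality. Subtracting the null vector K from D does not change its
pairing with the gradient, so Cauchy–Schwarz needs only ‖D − K‖, which the growth condition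
controls. -/
lemma le_norm_gramVec (hμ : 0 < μ) (D : E) : μ * R.gram D D ≤ 2 * ‖R.gramVec D‖ ^ 2 := by
  obtain ⟨K, hK, h⟩ := hR.exists_norm_le hμ D
  have hv := R.gram_self_nonneg D
  have h1 : R.gram D D ≤ ‖R.gramVec D‖ * (Real.sqrt (2 / μ) * Real.sqrt (R.gram D D)) := by
    have : R.gram D D = ⟪R.gramVec D, D - K⟫ := by
      rw [inner_gramVec, map_sub, R.gram_eq_zero_of_self hK, sub_zero]
    calc R.gram D D = ⟪R.gramVec D, D - K⟫ := this
      _ ≤ ‖R.gramVec D‖ * ‖D - K‖ := real_inner_le_norm _ _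
      _ ≤ _ := by gcongr
  have h2 : R.gram D D ^ 2 ≤ ‖R.gramVec D‖ ^ 2 * (2 / μ * R.gram D D) := by
    calc R.gram D D ^ 2 ≤ (‖R.gramVec D‖ * (Real.sqrt (2 / μ) * Real.sqrt (R.gram D D))) ^ 2 :=
          pow_le_pow_left₀ hv h1 2
      _ = _ := by rw [mul_pow, mul_pow, Real.sq_sqrt (by positivity), Real.sq_sqrt hv]
  rcases hv.eq_or_lt with h0 | h0
  · rw [← h0, mul_zero]; positivity
  · have h3 : ‖R.gramVec D‖ ^ 2 * (2 / μ * R.gram D D) =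
        2 * ‖R.gramVec D‖ ^ 2 / μ * R.gram D D := by ring
    rw [h3, pow_two, mul_le_mul_iff_left₀ h0, le_div_iff₀ hμ] at h2
    linarith

/-- The excess risk does not bound the null component K of L − L₀, but almost every design
annihilates K, so only L₀ and L − L₀ − K enter the residual. The exceptional set does not depend on
the direction U. -/
lemma sqrt_gram_gradEstimate_le (hμ : 0 < μ) (hψ : 0 < ψ) (L : E) :
    ∀ᵐ ω ∂P, ∀ U, Real.sqrt (R.gram (R.gradEstimate L (ω, U)) (R.gradEstimate L (ω, U))) ≤
      noiseConst (Module.finrank ℝ E) μ ψ κ *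
        (1 + Real.sqrt (R.gram (L - L₀) (L - L₀))) * R.envelope ω := by
  obtain ⟨K, hK, hDK⟩ := hR.exists_norm_le hμ (L - L₀)
  filter_upwards [R.design_ae_eq_zero hK] with ω hω U
  set v := R.gram (L - L₀) (L - L₀)
  set d : ℝ := (Module.finrank ℝ E : ℝ)
  have hd0 : 0 ≤ d := Nat.cast_nonneg _
  have hU : ‖(U : E)‖ = 1 := by simp
  have hres : ‖R.target ω - R.design ω L‖ ≤ ‖R.target ω‖ +
      R.size ω * Real.sqrt (2 * κ / μ) + R.size ω * (Real.sqrt (2 / μ) * Real.sqrt v) := by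
    have h1 : R.design ω L = R.design ω L₀ + R.design ω (L - L₀ - K) := by
      simp [hω]
    have h2 : ‖R.design ω L₀‖ ≤ R.size ω * Real.sqrt (2 * κ / μ) :=
      (R.norm_design_le ω L₀).trans
        (mul_le_mul_of_nonneg_left (Real.le_sqrt_of_sq_le hR.norm_sq_le) (R.size_nonneg ω))
    have h3 : ‖R.design ω (L - L₀ - K)‖ ≤ R.size ω * (Real.sqrt (2 / μ) * Real.sqrt v) :=
      (R.norm_design_le ω _).trans (mul_le_mul_of_nonneg_left hDK (R.size_nonneg ω))
    rw [h1]
    calc _ ≤ ‖R.target ω‖ + ‖R.design ω L₀ + R.design ω (L - L₀ - K)‖ := norm_sub_le _ _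
      _ ≤ _ := by linarith [norm_add_le (R.design ω L₀) (R.design ω (L - L₀ - K))]
  have hsz := R.size_nonneg ω
  have hprod : ‖R.target ω - R.design ω L‖ * R.size ω ≤
      (1 + Real.sqrt (2 * κ / μ) + Real.sqrt (2 / μ)) * (1 + Real.sqrt v) * R.envelope ω := by
    have h1 : R.size ω ^ 2 ≤ R.envelope ω := by unfold envelope; nlinarith [sq_nonneg ‖R.target ω‖]
    have h2 : ‖R.target ω‖ * R.size ω ≤ R.envelope ω := by
      unfold envelope; nlinarith [sq_nonneg (‖R.target ω‖ - R.size ω), sq_nonneg ‖R.target ω‖]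
    have ha := Real.sqrt_nonneg (2 * κ / μ)
    have hb := Real.sqrt_nonneg (2 / μ)
    have hc := Real.sqrt_nonneg v
    have he := R.envelope_nonneg ω
    calc _ ≤ (‖R.target ω‖ + R.size ω * Real.sqrt (2 * κ / μ) +
          R.size ω * (Real.sqrt (2 / μ) * Real.sqrt v)) * R.size ω := by gcongr
      _ = ‖R.target ω‖ * R.size ω + Real.sqrt (2 * κ / μ) * R.size ω ^ 2 +
          Real.sqrt (2 / μ) * Real.sqrt v * R.size ω ^ 2 := by ring
      _ ≤ R.envelope ω + Real.sqrt (2 * κ / μ) * R.envelope ω +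
          Real.sqrt (2 / μ) * Real.sqrt v * R.envelope ω := by gcongr
      _ = (1 + Real.sqrt (2 * κ / μ) + Real.sqrt (2 / μ) * Real.sqrt v) * R.envelope ω := by ring
      _ ≤ _ := by
        gcongr
        nlinarith [mul_nonneg ha hc]
  have hg : ‖R.gradEstimate L (ω, U)‖ ≤ 2 * d * (‖R.target ω - R.design ω L‖ * R.size ω) := by
    rw [gradEstimate, norm_smul, hU, mul_one, Real.norm_eq_abs, abs_mul]
    have h1 : |(-2 * d : ℝ)| = 2 * d := by
      rw [abs_mul, abs_neg, abs_of_nonneg hd0, abs_of_nonneg (by norm_num : (0 : ℝ) ≤ 2)]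
    rw [h1]
    refine mul_le_mul_of_nonneg_left ((abs_real_inner_le_norm _ _).trans ?_) (by positivity)
    refine mul_le_mul_of_nonneg_left ?_ (norm_nonneg _)
    simpa using R.norm_design_le ω U
  calc _ ≤ Real.sqrt (ψ / 2 * ‖R.gradEstimate L (ω, U)‖ ^ 2) := Real.sqrt_le_sqrt (hR.smooth _)
    _ = Real.sqrt (ψ / 2) * ‖R.gradEstimate L (ω, U)‖ := by
      rw [Real.sqrt_mul (by positivity), Real.sqrt_sq (norm_nonneg _)]
    _ ≤ Real.sqrt (ψ / 2) * (2 * d * ((1 + Real.sqrt (2 * κ / μ) + Real.sqrt (2 / μ)) *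
        (1 + Real.sqrt v) * R.envelope ω)) := by
      gcongr
      exact hg.trans (by gcongr)
    _ = _ := by rw [noiseConst]; ring

end Controlled

lemma measurable_gram_gradEstimate (R : Regression P E H) (D L : E) :
    Measurable fun z => R.gram D (R.gradEstimate L z) := by
  have h1 : Measurable fun z : Ω × Metric.sphere (0 : E) 1 => R.design z.1 z.2 :=
    R.measurable_design.comp (measurable_fst.prodMk (measurable_subtype_coe.comp measurable_snd))
  have h2 : Measurable fun z : Ω × Metric.sphere (0 : E) 1 => R.target z.1 - R.design z.1 L :=
    (R.measurable_target.comp measurable_fst).sub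
      ((R.measurable_design_apply L).comp measurable_fst)
  have h3 : Measurable fun z : Ω × Metric.sphere (0 : E) 1 => R.gram D z.2 :=
    ((LinearMap.continuous_of_finiteDimensional (R.gram D)).comp
      continuous_subtype_val).measurable.comp measurable_snd
  simp only [gradEstimate, map_smul, smul_eq_mul]
  exact ((h2.inner h1).const_mul _).mul h3

/-- For fixed U the normal equations give the mean over the data, −gram(L − L₀, U); isotropy of U
then turns the dimension factor times a mean square into the squared norm. -/
lemma integral_gram_gradEstimate [IsProbabilityMeasure P] (hR : R.Controlled μ ψ κ L₀)
    {σ : Measure (Metric.sphere (0 : E) 1)} [IsProbabilityMeasure σ]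
    (hσ : ∀ e : E ≃ₗᵢ[ℝ] E, σ.map (sphereIsometry e) = σ) (L : E)
    (hint : Integrable (fun z => R.gram (L - L₀) (R.gradEstimate L z)) (P.prod σ)) :
    ∫ z, R.gram (L - L₀) (R.gradEstimate L z) ∂(P.prod σ) = 2 * ‖R.gramVec (L - L₀)‖ ^ 2 := by
  rw [integral_prod_symm _ hint, ← integral_inner_sq_sphere σ hσ, ← integral_const_mul,
    ← integral_const_mul]
  refine integral_congr_ae (.of_forall fun U => ?_)
  simp only [gradEstimate, map_smul, smul_eq_mul, inner_gramVec]
  rw [integral_mul_const, integral_const_mul]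
  have := R.corr_eq_neg_gram hR.corr_eq_zero L U
  rw [corr] at this
  rw [this]
  ring

/-- The linear Taylor term has the exact gradient as its mean, and the Polyak–Łojasiewicz inequality
makes it a drift; the exponential moment controls the quadratic term. As the noise scales like 1+√V,
steps are measured against √w with w = max(V, s/2). The floor s/2 lets √w absorb the 1, at the price
of √(2/s) in β. -/
theorem lintegral_pow_step_le [IsProbabilityMeasure P] (hμ : 0 < μ) (hψ : 0 < ψ)
    (hR : R.Controlled μ ψ κ L₀)
    {σ : Measure (Metric.sphere (0 : E) 1)} [IsProbabilityMeasure σ]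
    (hσ : ∀ e : E ≃ₗᵢ[ℝ] E, σ.map (sphereIsometry e) = σ) {l B : ℝ} (hl : 0 < l) (hB : 0 ≤ B)
    (hexp : ∫⁻ ω, ENNReal.ofReal (Real.exp (2 * l * R.envelope ω)) ∂P ≤ ENNReal.ofReal B)
    (L : E) (p : ℕ) {η s β : ℝ} (hη : 0 < η) (hs : 0 < s) (hβ : β = η * (1 + Real.sqrt (2 / s)))
    (hsmall : 2 * (p + 2) * (noiseConst (Module.finrank ℝ E) μ ψ κ * β) ≤ l) :
    ∫⁻ z, ENNReal.ofReal (R.gram (L - η • R.gradEstimate L z - L₀)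
        (L - η • R.gradEstimate L z - L₀) ^ (p + 2)) ∂(P.prod σ) ≤
      ENNReal.ofReal ((1 - 2 * (p + 2) * η * μ) * R.gram (L - L₀) (L - L₀) ^ (p + 2) +
        10 * (noiseConst (Module.finrank ℝ E) μ ψ κ / l) ^ 2 * B * ((p + 2) * β) ^ 2 *
          max (R.gram (L - L₀) (L - L₀)) (s / 2) ^ (p + 2)) := by
  set C := noiseConst (Module.finrank ℝ E) μ ψ κ with hC
  have hC0 : 0 ≤ C := noiseConst_nonneg _ _ _ _
  set v := R.gram (L - L₀) (L - L₀) with hv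
  have hv0 : 0 ≤ v := R.gram_self_nonneg _
  set w := max v (s / 2) with hw
  have hvw : v ≤ w := le_max_left _ _
  have hsw : s / 2 ≤ w := le_max_right _ _
  have hw0 : 0 < w := (half_pos hs).trans_le hsw
  have hβ0 : 0 ≤ β := by rw [hβ]; positivity
  have hp : (0 : ℝ) ≤ p := Nat.cast_nonneg p
  have hsqrt : η * (1 + Real.sqrt v) ≤ Real.sqrt w * β := by
    have h1 : Real.sqrt v ≤ Real.sqrt w := Real.sqrt_le_sqrt hvw
    have h2 : 1 ≤ Real.sqrt w * Real.sqrt (2 / s) := by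
      rw [← Real.sqrt_mul hw0.le, Real.one_le_sqrt, mul_div_assoc', le_div_iff₀ hs]
      linarith
    rw [hβ]
    nlinarith
  have hae : ∀ᵐ z ∂(P.prod σ), η * Real.sqrt (R.gram (R.gradEstimate L z) (R.gradEstimate L z)) ≤
      Real.sqrt w * (C * β * R.envelope z.1) := by
    filter_upwards [Measure.quasiMeasurePreserving_fst.ae
      (hR.sqrt_gram_gradEstimate_le hμ hψ L)] with z hz
    calc _ ≤ η * (C * (1 + Real.sqrt v) * R.envelope z.1) := by gcongr; exact hz z.2
      _ = η * (1 + Real.sqrt v) * (C * R.envelope z.1) := by ring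
      _ ≤ Real.sqrt w * β * (C * R.envelope z.1) :=
        mul_le_mul_of_nonneg_right hsqrt (mul_nonneg hC0 (R.envelope_nonneg _))
      _ = _ := by ring
  have hy0 (ω : Ω) : 0 ≤ C * β * R.envelope ω :=
    mul_nonneg (mul_nonneg hC0 hβ0) (R.envelope_nonneg ω)
  have hX : ∀ᵐ z ∂(P.prod σ), |η * R.gram (L - L₀) (R.gradEstimate L z)| ≤
      w * (C * β * R.envelope z.1) := by
    filter_upwards [hae] with z hz
    rw [abs_mul, abs_of_pos hη]
    calc _ ≤ η * (Real.sqrt v * Real.sqrt (R.gram (R.gradEstimate L z) (R.gradEstimate L z))) :=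
          mul_le_mul_of_nonneg_left (R.abs_gram_le _ _) hη.le
      _ = Real.sqrt v * (η * Real.sqrt (R.gram (R.gradEstimate L z) (R.gradEstimate L z))) := by
          ring
      _ ≤ Real.sqrt w * (Real.sqrt w * (C * β * R.envelope z.1)) := by gcongr
      _ = _ := by rw [← mul_assoc, Real.mul_self_sqrt hw0.le]
  have hexpint : Integrable (fun ω => Real.exp (2 * l * R.envelope ω)) P := by
    refine ⟨((R.measurable_envelope.const_mul _).exp).aestronglyMeasurable, ?_⟩
    rw [hasFiniteIntegral_iff_ofReal (.of_forall fun _ => (Real.exp_pos _).le)]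
    exact hexp.trans_lt ENNReal.ofReal_lt_top
  have hexple : ∫ ω, Real.exp (2 * l * R.envelope ω) ∂P ≤ B := by
    rw [integral_eq_lintegral_of_nonneg_ae (.of_forall fun _ => (Real.exp_pos _).le) hexpint.1]
    exact ENNReal.toReal_le_of_le_ofReal hB hexp
  have henvint : Integrable R.envelope P := by
    refine (hexpint.const_mul (1 / (2 * l))).mono' R.measurable_envelope.aestronglyMeasurable
      (.of_forall fun ω => ?_)
    rw [Real.norm_of_nonneg (R.envelope_nonneg ω), one_div, inv_mul_eq_div,
      le_div_iff₀ (by positivity)]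
    linarith [Real.add_one_le_exp (2 * l * R.envelope ω)]
  have hXint : Integrable (fun z => R.gram (L - L₀) (R.gradEstimate L z)) (P.prod σ) := by
    refine ((henvint.comp_fst σ).const_mul (w * (C * β) / η)).mono'
      (R.measurable_gram_gradEstimate _ _).aestronglyMeasurable ?_
    filter_upwards [hX] with z hz
    rw [abs_mul, abs_of_pos hη] at hz
    rw [Real.norm_eq_abs, div_mul_eq_mul_div, le_div_iff₀ hη]
    linarith
  set A := 10 * (C / l) ^ 2 * ((p + 2) * β) ^ 2 * w ^ (p + 2) with hA
  have hA0 : 0 ≤ A := by positivity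
  have hΦint : Integrable (fun z : Ω × Metric.sphere (0 : E) 1 =>
      v ^ (p + 2) - 2 * (p + 2) * η * v ^ (p + 1) * R.gram (L - L₀) (R.gradEstimate L z) +
        A * Real.exp (2 * l * R.envelope z.1)) (P.prod σ) :=
    ((integrable_const _).sub (hXint.const_mul _)).add ((hexpint.comp_fst σ).const_mul A)
  have hpt : ∀ᵐ z ∂(P.prod σ), R.gram (L - η • R.gradEstimate L z - L₀)
      (L - η • R.gradEstimate L z - L₀) ^ (p + 2) ≤
      v ^ (p + 2) - 2 * (p + 2) * η * v ^ (p + 1) * R.gram (L - L₀) (R.gradEstimate L z) +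
        A * Real.exp (2 * l * R.envelope z.1) := by
    filter_upwards [hae, hX] with z hz hzX
    have hq0 := R.gram_self_nonneg (R.gradEstimate L z)
    have hQ : η ^ 2 * R.gram (R.gradEstimate L z) (R.gradEstimate L z) ≤
        w * (C * β * R.envelope z.1) ^ 2 := by
      have := pow_le_pow_left₀ (by positivity) hz 2
      rwa [mul_pow, mul_pow, Real.sq_sqrt hq0, Real.sq_sqrt hw0.le] at this
    have hnew : R.gram (L - η • R.gradEstimate L z - L₀) (L - η • R.gradEstimate L z - L₀) =
        v - 2 * η * R.gram (L - L₀) (R.gradEstimate L z) +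
          η ^ 2 * R.gram (R.gradEstimate L z) (R.gradEstimate L z) := by
      rw [sub_right_comm, gram_sub_smul_self]
    rw [hnew]
    refine (pow_step_le p hv0 hvw (hy0 z.1) hzX hq0 hQ
      (by rw [← hnew]; exact R.gram_self_nonneg _)).trans ?_
    have h1 := sq_mul_exp_le (R.envelope_nonneg z.1) hl (y := C * β * R.envelope z.1) rfl
      (k := 2 * (p + 2)) hsmall
    have h2 := mul_le_mul_of_nonneg_left h1
      (by positivity : 0 ≤ 5 * ((p : ℝ) + 2) ^ 2 * w ^ (p + 2))
    refine add_le_add le_rfl (h2.trans (le_of_eq ?_))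
    rw [hA]; ring
  calc _ ≤ ∫⁻ z, ENNReal.ofReal (v ^ (p + 2) - 2 * (p + 2) * η * v ^ (p + 1) *
          R.gram (L - L₀) (R.gradEstimate L z) + A * Real.exp (2 * l * R.envelope z.1))
          ∂(P.prod σ) :=
        lintegral_mono_ae (hpt.mono fun z hz => ENNReal.ofReal_le_ofReal hz)
    _ = ENNReal.ofReal (∫ z, (v ^ (p + 2) - 2 * (p + 2) * η * v ^ (p + 1) *
          R.gram (L - L₀) (R.gradEstimate L z) + A * Real.exp (2 * l * R.envelope z.1))
          ∂(P.prod σ)) :=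
        (ofReal_integral_eq_lintegral_ofReal hΦint (hpt.mono fun z hz =>
          (pow_nonneg (R.gram_self_nonneg _) _).trans hz)).symm
    _ ≤ _ := by
        refine ENNReal.ofReal_le_ofReal ?_
        have hXint' := hXint.const_mul (2 * (p + 2) * η * v ^ (p + 1))
        have hsub : Integrable (fun z : Ω × Metric.sphere (0 : E) 1 => v ^ (p + 2) -
            2 * (p + 2) * η * v ^ (p + 1) * R.gram (L - L₀) (R.gradEstimate L z)) (P.prod σ) :=
          (integrable_const _).sub hXint'
        rw [integral_add hsub ((hexpint.comp_fst σ).const_mul A),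
          integral_sub (integrable_const _) hXint', integral_const_mul, integral_const_mul,
          integral_gram_gradEstimate hR hσ L hXint,
          integral_fun_fst (fun ω => Real.exp (2 * l * R.envelope ω))]
        simp only [integral_const, probReal_univ, one_smul]
        have h1 := mul_le_mul_of_nonneg_left (hR.le_norm_gramVec hμ (L - L₀))
          (by positivity : 0 ≤ 2 * ((p : ℝ) + 2) * η * v ^ (p + 1))
        have h2 := mul_le_mul_of_nonneg_left hexple hA0
        calc _ ≤ v ^ (p + 2) - 2 * (p + 2) * η * v ^ (p + 1) * (μ * v) + A * B := by linarith
          _ = _ := by rw [hA]; ring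

end Regression

end OneStep

/-! ### The h-th subproblem as a least-squares problem. -/

section Subproblem

variable {n m : ℕ} (S : GaussianSystem n m) (F : ℕ → Param n m) (h : ℕ)

lemma continuous_state (t : ℕ) : Continuous fun ξ => state S ξ t := by
  induction t with
  | zero => exact continuous_fst
  | succ t ih =>
    simp only [state]
    fun_prop

lemma continuous_output (t : ℕ) : Continuous fun ξ => output S ξ t := by
  have := continuous_state S t
  simp only [output]
  fun_prop

lemma continuous_blockA : Continuous (Param.blockA : Param n m → _) := by
  refine continuous_matrix fun i j => ?_
  simp only [Param.blockA, Matrix.of_apply]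
  fun_prop

lemma continuous_blockB : Continuous (Param.blockB : Param n m → _) := by
  refine continuous_matrix fun i j => ?_
  simp only [Param.blockB, Matrix.of_apply]
  fun_prop

/-- Continuity is joint in parameters and noise because in the full algorithm the earlier parameters
are random; it supplies measurability later. -/
lemma continuous_estimate (t : ℕ) :
    Continuous fun p : (ℕ → Param n m) × Traj n m => estimate S p.1 p.2 t := by
  induction t with
  | zero => exact continuous_const
  | succ t ih =>
    simp only [estimate]
    have h1 : Continuous fun p : (ℕ → Param n m) × Traj n m => output S p.2 t :=
      (continuous_output S t).comp continuous_snd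
    have h2 : Continuous fun p : (ℕ → Param n m) × Traj n m => (p.1 t).blockA :=
      continuous_blockA.comp (by fun_prop)
    have h3 : Continuous fun p : (ℕ → Param n m) × Traj n m => (p.1 t).blockB :=
      continuous_blockB.comp (by fun_prop)
    fun_prop

lemma continuous_empiricalCost :
    Continuous fun p : ((ℕ → Param n m) × Param n m) × Traj n m =>
      empiricalCost S p.1.1 h p.2 p.1.2 := by
  unfold empiricalCost
  refine continuous_finsetSum _ fun t _ => ?_
  have h1 : Continuous fun p : ((ℕ → Param n m) × Param n m) × Traj n m => state S p.2 t :=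
    (continuous_state S t).comp continuous_snd
  have h2 : Continuous fun p : ((ℕ → Param n m) × Param n m) × Traj n m =>
      (Function.update p.1.1 h p.1.2, p.2) :=
    (Continuous.update (by fun_prop) h (by fun_prop)).prodMk continuous_snd
  exact ((h1.sub ((continuous_estimate S t).comp h2)).norm).pow 2

lemma estimate_congr {F F' : ℕ → Param n m} (ξ : Traj n m) {t : ℕ} (h : ∀ s < t, F s = F' s) :
    estimate S F ξ t = estimate S F' ξ t := by
  induction t with
  | zero => rfl
  | succ t ih =>
    simp only [estimate]
    rw [ih fun s hs => h s (by omega), h t (by omega)]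

lemma empiricalCost_congr {F F' : ℕ → Param n m} {h : ℕ} (hF : ∀ s < h, F s = F' s) (ξ : Traj n m) :
    empiricalCost S F h ξ = empiricalCost S F' h ξ := by
  ext L
  refine Finset.sum_congr rfl fun t ht => ?_
  rw [estimate_congr S ξ fun s hs => ?_]
  rcases eq_or_ne s h with rfl | hne
  · simp
  · have := Finset.mem_range.1 ht
    rw [Function.update_of_ne hne, Function.update_of_ne hne, hF s (by omega)]

lemma cost_congr {F F' : ℕ → Param n m} {h : ℕ} (hF : ∀ s < h, F s = F' s) :
    cost S F h = cost S F' h := by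
  ext L
  simp only [cost, empiricalCost_congr S hF]

/-- The filter input `(xhat h, y h)`. -/
def regressor (ξ : Traj n m) : EuclideanSpace ℝ (Fin n ⊕ Fin m) :=
  WithLp.toLp 2 (Sum.elim (estimate S F ξ h).ofLp (output S ξ h).ofLp)

/-- The prediction `L (xhat h, y h)`. -/
def prediction (ξ : Traj n m) : Param n m →ₗ[ℝ] EuclideanSpace ℝ (Fin n) where
  toFun L := WithLp.toLp 2 fun i => ∑ j, L (i, j) * regressor S F h ξ j
  map_add' L L' := by
    ext i
    simp [add_mul, Finset.sum_add_distrib]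
  map_smul' a L := by
    ext i
    simp [mul_assoc, Finset.mul_sum, mul_add]

lemma prediction_apply (ξ : Traj n m) (L : Param n m) (i : Fin n) :
    prediction S F h ξ L i = ∑ j, L (i, j) * regressor S F h ξ j := rfl

lemma estimate_update_succ (ξ : Traj n m) (L : Param n m) :
    estimate S (Function.update F h L) ξ (h + 1) = prediction S F h ξ L := by
  have h1 : estimate S (Function.update F h L) ξ h = estimate S F ξ h :=
    estimate_congr S ξ fun s hs => Function.update_of_ne hs.ne _ _
  ext i
  rw [prediction_apply]
  simp only [estimate, h1, Function.update_self, regressor, Fintype.sum_sum_type, Sum.elim_inl,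
    Sum.elim_inr]
  simp [Matrix.mulVec, dotProduct, Param.blockA, Param.blockB]

lemma norm_prediction_le (ξ : Traj n m) (L : Param n m) :
    ‖prediction S F h ξ L‖ ≤ ‖regressor S F h ξ‖ * ‖L‖ := by
  refine le_of_sq_le_sq ?_ (by positivity)
  rw [mul_pow, EuclideanSpace.real_norm_sq_eq, EuclideanSpace.real_norm_sq_eq,
    EuclideanSpace.real_norm_sq_eq, Fintype.sum_prod_type, mul_comm, Finset.sum_mul]
  refine Finset.sum_le_sum fun i _ => ?_
  rw [prediction_apply]
  exact Finset.sum_mul_sq_le_sq_mul_sq _ _ _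

lemma continuous_regressor : Continuous fun ξ => regressor S F h ξ := by
  have h1 : Continuous fun ξ => estimate S F ξ h :=
    (continuous_estimate S h).comp (continuous_const.prodMk continuous_id)
  have h2 := continuous_output S h
  refine (PiLp.continuous_toLp 2 _).comp (continuous_pi fun j => ?_)
  rcases j with j | j
  · simp only [Sum.elim_inl]; fun_prop
  · simp only [Sum.elim_inr]; fun_prop

lemma continuous_prediction :
    Continuous fun p : Traj n m × Param n m => prediction S F h p.1 p.2 := by
  have h1 : Continuous fun p : Traj n m × Param n m => regressor S F h p.1 :=
    (continuous_regressor S F h).comp continuous_fst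
  refine (PiLp.continuous_toLp 2 _).comp (continuous_pi fun i => ?_)
  refine continuous_finsetSum _ fun j _ => ?_
  exact Continuous.mul (by fun_prop) ((EuclideanSpace.proj (𝕜 := ℝ) j).continuous.comp h1)

lemma isNoiseAffine_regressor (j : Fin n ⊕ Fin m) :
    IsNoiseAffine (h + 1) fun ξ => regressor S F h ξ j := by
  rcases j with j | j
  · exact isNoiseAffine_estimate S F (Nat.le_succ h) j
  · exact isNoiseAffine_output S (Nat.lt_succ_self h) j

lemma memLp_of_isNoiseAffine {ι : Type*} [Fintype ι] {T : ℕ} {Y : Traj n m → EuclideanSpace ℝ ι}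
    (hY : ∀ i, IsNoiseAffine T fun ξ => Y ξ i) : MemLp Y 2 (trajLaw S) :=
  MemLp.of_eval_piLp fun i => ((hY i).hasGaussianLaw S).memLp_two

/-- The `h`-th subproblem as a regression problem. -/
noncomputable def regression : Regression (trajLaw S) (Param n m) (EuclideanSpace ℝ (Fin n)) where
  target ξ := state S ξ (h + 1)
  design ξ := prediction S F h ξ
  size ξ := ‖regressor S F h ξ‖
  size_nonneg _ := norm_nonneg _
  norm_design_le := norm_prediction_le S F h
  measurable_target := (continuous_state S _).measurable
  measurable_design := (continuous_prediction S F h).measurable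
  measurable_size := (continuous_regressor S F h).norm.measurable
  memLp_target := memLp_of_isNoiseAffine S (isNoiseAffine_state S le_rfl)
  memLp_size := (memLp_of_isNoiseAffine S (isNoiseAffine_regressor S F h)).norm

/-- The part of the cost that does not depend on the parameter to be optimized. -/
noncomputable def pastCost (ξ : Traj n m) : ℝ :=
  ∑ t ∈ Finset.range (h + 1), ‖state S ξ t - estimate S F ξ t‖ ^ 2

lemma empiricalCost_eq (ξ : Traj n m) (L : Param n m) :
    empiricalCost S F h ξ L = pastCost S F h ξ +
      ‖(regression S F h).target ξ - (regression S F h).design ξ L‖ ^ 2 := by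
  rw [empiricalCost, Finset.sum_range_succ, estimate_update_succ]
  congr 1
  refine Finset.sum_congr rfl fun t ht => ?_
  have := Finset.mem_range.1 ht
  rw [estimate_congr S ξ fun s hs => Function.update_of_ne (by omega : s ≠ h) L F]

lemma integrable_pastCost : Integrable (pastCost S F h) (trajLaw S) := by
  refine integrable_finsetSum _ fun t _ => ?_
  have h1 : MemLp (fun ξ => state S ξ t - estimate S F ξ t) 2 (trajLaw S) :=
    (memLp_of_isNoiseAffine S (isNoiseAffine_state S le_rfl)).sub
      (memLp_of_isNoiseAffine S (isNoiseAffine_estimate S F le_rfl))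
  exact h1.integrable_norm_pow two_ne_zero

lemma cost_eq (L : Param n m) :
    cost S F h L = ∫ ξ, pastCost S F h ξ ∂(trajLaw S) + (regression S F h).risk L := by
  simp only [cost, empiricalCost_eq]
  exact integral_add (integrable_pastCost S F h) ((regression S F h).integrable_residual_sq L)

lemma isMinOn_cost_iff (L : Param n m) :
    IsMinOn (cost S F h) univ L ↔
      ∀ L', (regression S F h).risk L ≤ (regression S F h).risk L' := by
  simp [isMinOn_iff, cost_eq]

lemma hasGradientAt_cost (L : Param n m) :
    HasGradientAt (cost S F h)
      ((2 : ℝ) • ((regression S F h).gramOp L - (regression S F h).corrVec)) L := by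
  have := (regression S F h).hasGradientAt_risk L
  rw [hasGradientAt_iff_hasFDerivAt] at this ⊢
  rw [show cost S F h = fun L => _ from funext (cost_eq S F h)]
  exact this.const_add _

lemma finrank_param : Module.finrank ℝ (Param n m) = n * (m + n) := by
  simp [add_comm]

/-- The past cost and the terms even in r cancel in the difference. The cross term that remains is
linear in r, and the factor 1/(2r) normalizes it. -/
lemma oracle_eq {r : ℝ} (hr : r ≠ 0) (L : Param n m) (s : Sample n m) :
    oracle S F h L r s = (regression S F h).gradEstimate L s := by
  have h1 (a : ℝ) (x y z : EuclideanSpace ℝ (Fin n)) :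
      ‖x - (y + a • z)‖ ^ 2 = ‖x - y‖ ^ 2 - 2 * a * ⟪x - y, z⟫ + a ^ 2 * ‖z‖ ^ 2 := by
    rw [← sub_sub, norm_sub_sq_real, real_inner_smul_right, norm_smul, mul_pow, Real.norm_eq_abs,
      sq_abs]
    ring
  rw [oracle, Regression.gradEstimate, empiricalCost_eq, empiricalCost_eq, sub_eq_add_neg L,
    ← neg_smul, map_add, map_add, map_smul, map_smul, h1, h1, finrank_param]
  congr 1
  push_cast
  field_simp
  ring

end Subproblem

/-! ### Problem constants and what they control. -/

section Constants

variable {n m : ℕ} {S : GaussianSystem n m} {F : ℕ → Param n m} {h : ℕ} {μ ψ κ : ℝ}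

lemma HasConstants.congr {F' : ℕ → Param n m} (hF : ∀ s < h, F s = F' s)
    (H : HasConstants S F h μ ψ κ) : HasConstants S F' h μ ψ κ := by
  obtain ⟨h1, h2, h3, h4⟩ := H
  rw [cost_congr S hF] at h1 h2 h3
  exact ⟨h1, h2, h3, h4⟩

lemma HasConstants.mono {μ' ψ' κ' : ℝ} (hμ : μ' ≤ μ) (hψ : ψ ≤ ψ') (hκ : κ ≤ κ')
    (H : HasConstants S F h μ ψ κ) : HasConstants S F h μ' ψ' κ' where
  growth L := by
    obtain ⟨L', h1, h2⟩ := H.growth L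
    exact ⟨L', h1, (by gcongr : _ ≤ μ / 2 * ‖L - L'‖ ^ 2).trans h2⟩
  differentiable := H.differentiable
  smooth L L' := (H.smooth L L').trans (by gcongr)
  moment := H.moment.trans hκ

variable (S F h) in
lemma exists_hasConstants :
    ∃ μ ψ κ : ℝ, 0 < μ ∧ 0 < ψ ∧ 0 < κ ∧ HasConstants S F h μ ψ κ := by
  set R := regression S F h with hR
  obtain ⟨μ, hμ, hgrowth⟩ := R.exists_gram_growth
  obtain ⟨L₀, hL₀⟩ := R.exists_corr_eq_zero
  -- The factor 2 in front of μ offsets the μ/2 in the growth condition; the Hessian is twice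
  -- `gramOp`; the added 1s only ensure positivity.
  refine ⟨2 * μ, 2 * ‖LinearMap.toContinuousLinearMap R.gramOp‖ + 1,
    ∫ ξ, ‖state S ξ (h + 1)‖ ^ 2 ∂(trajLaw S) + 1, by positivity, by positivity,
    by positivity, ?_, fun L => (hasGradientAt_cost S F h L).differentiableAt, ?_, by linarith⟩
  · intro L
    obtain ⟨K, hK, hK'⟩ := hgrowth (L - L₀)
    have h1 := R.risk_sub_risk hL₀
    have h2 : R.risk (L₀ + K) = R.risk L₀ := by
      have := h1 (L₀ + K)
      rw [add_sub_cancel_left, hK] at this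
      linarith
    refine ⟨L₀ + K, (isMinOn_cost_iff S F h _).2 fun L' => ?_, ?_⟩
    · rw [← hR, h2]
      linarith [h1 L', R.gram_self_nonneg (L' - L₀)]
    · rw [cost_eq, cost_eq, ← hR, h2, add_sub_add_left_eq_sub, h1, ← sub_sub]
      linarith
  · intro L L'
    rw [(hasGradientAt_cost S F h L).gradient, (hasGradientAt_cost S F h L').gradient, ← smul_sub,
      sub_sub_sub_cancel_right, ← map_sub, norm_smul, ← hR, Real.norm_of_nonneg (by norm_num)]
    have := (LinearMap.toContinuousLinearMap R.gramOp).le_opNorm (L - L')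
    rw [LinearMap.coe_toContinuousLinearMap'] at this
    linarith [norm_nonneg (L - L')]

variable (S F) in
lemma exists_hasConstants_lt (N : ℕ) :
    ∃ μ ψ κ : ℝ, 0 < μ ∧ 0 < ψ ∧ 0 < κ ∧ ∀ h < N, HasConstants S F h μ ψ κ := by
  induction N with
  | zero => exact ⟨1, 1, 1, one_pos, one_pos, one_pos, fun h hh => absurd hh (Nat.not_lt_zero h)⟩
  | succ N ih =>
    obtain ⟨μ, ψ, κ, hμ, hψ, hκ, H⟩ := ih
    obtain ⟨μ', ψ', κ', hμ', hψ', hκ', H'⟩ := exists_hasConstants S F N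
    refine ⟨min μ μ', max ψ ψ', max κ κ', by positivity, by positivity, by positivity,
      fun h hh => ?_⟩
    rcases Nat.lt_succ_iff_lt_or_eq.1 hh with hh | rfl
    · exact (H h hh).mono (min_le_left _ _) (le_max_left _ _) (le_max_left _ _)
    · exact H'.mono (min_le_right _ _) (le_max_right _ _) (le_max_right _ _)

/-- L₀ is the minimizer that the growth condition attaches to the starting point 0. The zero filter
has risk E‖x_{h+1}‖² ≤ κ, which bounds both ‖L₀‖ and the initial excess risk. -/
lemma HasConstants.exists_controlled (hμ : 0 < μ) (H : HasConstants S F h μ ψ κ) :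
    ∃ L₀, (regression S F h).Controlled μ ψ κ L₀ ∧ (regression S F h).gram L₀ L₀ ≤ κ := by
  set R := regression S F h with hR
  obtain ⟨L₀, hmin, hgr⟩ := H.growth 0
  have hmin' := (isMinOn_cost_iff S F h L₀).1 hmin
  have hcorr : ∀ M, R.corr L₀ M = 0 := R.corr_eq_zero hmin'
  have h0 : R.risk 0 ≤ κ := by
    have : R.risk 0 = ∫ ξ, ‖state S ξ (h + 1)‖ ^ 2 ∂(trajLaw S) := by
      simp [Regression.risk, hR, regression]
    rw [this]; exact H.moment
  have hq := R.risk_sub_risk hcorr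
  have hκ : R.risk 0 - R.risk L₀ ≤ κ := by linarith [R.risk_nonneg L₀]
  refine ⟨L₀, ⟨hcorr, fun M => ?_, fun M => ?_, ?_⟩, ?_⟩
  · obtain ⟨L₁, hmin₁, hgr₁⟩ := H.growth (L₀ + M)
    have h1 := (isMinOn_cost_iff S F h L₁).1 hmin₁
    have h2 : R.risk L₁ = R.risk L₀ := le_antisymm (h1 L₀) (hmin' L₁)
    refine ⟨L₁ - L₀, ?_, ?_⟩
    · rw [← hq, h2, sub_self]
    · rw [cost_eq, cost_eq, ← hR, h2, add_sub_add_left_eq_sub, hq, add_sub_cancel_left] at hgr₁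
      rwa [sub_sub_eq_add_sub, add_comm M]
  · have h1 := H.smooth M 0
    rw [(hasGradientAt_cost S F h M).gradient, (hasGradientAt_cost S F h 0).gradient, ← smul_sub,
      sub_sub_sub_cancel_right, ← map_sub, norm_smul, ← hR, Real.norm_of_nonneg (by norm_num),
      sub_zero] at h1
    have h2 := real_inner_le_norm (R.gramOp M) M
    rw [R.inner_gramOp] at h2
    nlinarith [norm_nonneg M]
  · rw [cost_eq, cost_eq, ← hR, add_sub_add_left_eq_sub, zero_sub, norm_neg] at hgr
    rw [le_div_iff₀ hμ]
    linarith
  · have := hq 0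
    rw [zero_sub] at this
    simp only [map_neg, LinearMap.neg_apply, neg_neg] at this
    linarith

/-- Smoothness bounds the second moments of the filter input: `gram` is tested on an elementary
matrix in row 0, whose prediction is a single regressor coordinate. -/
lemma HasConstants.integral_regressor_sq_le [NeZero n] (H : HasConstants S F h μ ψ κ)
    (hμ : 0 < μ) (j : Fin n ⊕ Fin m) :
    ∫ ξ, regressor S F h ξ j ^ 2 ∂(trajLaw S) ≤ ψ / 2 := by
  obtain ⟨L₀, hc, -⟩ := H.exists_controlled hμ
  have h1 := hc.smooth (EuclideanSpace.single (0, j) 1)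
  rw [Regression.gram_self, PiLp.norm_single] at h1
  simp only [norm_one, one_pow, mul_one] at h1
  refine le_trans (le_of_eq (integral_congr_ae (.of_forall fun ξ => ?_))) h1
  simp only [regression]
  rw [EuclideanSpace.real_norm_sq_eq, Finset.sum_eq_single 0]
  · rw [prediction_apply, Finset.sum_eq_single j]
    · simp
    · intro j' _ hj
      simp [hj]
    · simp
  · intro i _ hi
    rw [prediction_apply, Finset.sum_eq_zero, zero_pow two_ne_zero]
    intro j' _
    simp [hi]
  · simp

lemma HasConstants.integral_state_sq_le (H : HasConstants S F h μ ψ κ) (i : Fin n) :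
    ∫ ξ, state S ξ (h + 1) i ^ 2 ∂(trajLaw S) ≤ κ := by
  refine le_trans (integral_mono ?_ ?_ fun ξ => ?_) H.moment
  · exact ((isNoiseAffine_state S (le_refl (h + 1)) i).hasGaussianLaw S).memLp_two.integrable_sq
  · exact (memLp_of_isNoiseAffine S
      (isNoiseAffine_state S (le_refl (h + 1)))).integrable_norm_pow two_ne_zero
  · simp only
    rw [EuclideanSpace.real_norm_sq_eq]
    exact Finset.single_le_sum (f := fun i => state S ξ (h + 1) i ^ 2) (fun _ _ => sq_nonneg _)
      (Finset.mem_univ i)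

/-- The number of coordinates of the regressor and the target together. -/
def numCoords (n m : ℕ) : ℕ := n + m + n

/-- The scale at which the envelope has exponential moments. -/
noncomputable def expScale (n m : ℕ) (ψ κ : ℝ) : ℝ := (16 * numCoords n m * (ψ + κ))⁻¹

/-- The coordinates are dependent, so the largest one is used: the envelope is at most `numCoords`
times its square, and the exponential is at most the sum over all coordinates, each with mean at
most 2. The 16 in `expScale` is the 8 of the one-dimensional estimate times the 2 in the exponent.
-/
lemma HasConstants.lintegral_exp_envelope_le [NeZero n] (H : HasConstants S F h μ ψ κ)
    (hμ : 0 < μ) (hψ : 0 < ψ) (hκ : 0 < κ) :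
    ∫⁻ ξ, ENNReal.ofReal (Real.exp (2 * expScale n m ψ κ * (regression S F h).envelope ξ))
      ∂(trajLaw S) ≤ ENNReal.ofReal (2 * numCoords n m) := by
  let Y : (Fin n ⊕ Fin m) ⊕ Fin n → Traj n m → ℝ :=
    Sum.elim (fun j ξ => regressor S F h ξ j) (fun i ξ => state S ξ (h + 1) i)
  have hcard : Fintype.card ((Fin n ⊕ Fin m) ⊕ Fin n) = numCoords n m := by simp [numCoords]
  have hN : (0 : ℝ) < numCoords n m := by
    have := NeZero.pos n
    unfold numCoords
    exact_mod_cast (by omega : 0 < n + m + n)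
  have hl : 0 < expScale n m ψ κ := by unfold expScale; positivity
  have henv (ξ) : (regression S F h).envelope ξ = ∑ k, Y k ξ ^ 2 := by
    simp only [Regression.envelope, regression, Fintype.sum_sum_type (α₁ := Fin n ⊕ Fin m),
      EuclideanSpace.real_norm_sq_eq, Y, Sum.elim_inl, Sum.elim_inr]
  have hlaw (k) : HasGaussianLaw (Y k) (trajLaw S) := by
    rcases k with j | i
    · exact (isNoiseAffine_regressor S F h j).hasGaussianLaw S
    · exact (isNoiseAffine_state S (le_refl (h + 1)) i).hasGaussianLaw S
  have hmom (k) : ∫ ξ, Y k ξ ^ 2 ∂(trajLaw S) ≤ ψ + κ := by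
    rcases k with j | i
    · exact (H.integral_regressor_sq_le hμ j).trans (by linarith)
    · exact (H.integral_state_sq_le i).trans (by linarith)
  have hk (k) : ∫⁻ ξ, ENNReal.ofReal (Real.exp (2 * expScale n m ψ κ * numCoords n m *
      Y k ξ ^ 2)) ∂(trajLaw S) ≤ 2 := by
    refine lintegral_exp_mul_sq_le (hlaw k) (by positivity) ?_
    calc _ ≤ 8 * (2 * expScale n m ψ κ * numCoords n m) * (ψ + κ) := by gcongr; exact hmom k
      _ = 1 := by unfold expScale; field_simp; norm_num
  have hpt (ξ) : ENNReal.ofReal (Real.exp (2 * expScale n m ψ κ *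
      (regression S F h).envelope ξ)) ≤ ∑ k, ENNReal.ofReal (Real.exp (2 * expScale n m ψ κ *
        numCoords n m * Y k ξ ^ 2)) := by
    obtain ⟨k, -, hmax⟩ := Finset.exists_max_image (Finset.univ : Finset ((Fin n ⊕ Fin m) ⊕ Fin n))
      (fun k => Y k ξ ^ 2) ⟨Sum.inr 0, Finset.mem_univ _⟩
    have h1 : (regression S F h).envelope ξ ≤ numCoords n m * Y k ξ ^ 2 := by
      rw [henv, ← hcard, ← nsmul_eq_mul, ← Finset.card_univ]
      exact Finset.sum_le_card_nsmul _ _ _ fun j hj => hmax j hj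
    refine le_trans (ENNReal.ofReal_le_ofReal (Real.exp_le_exp.2 ?_))
      (Finset.single_le_sum (f := fun k => ENNReal.ofReal (Real.exp (2 * expScale n m ψ κ *
        numCoords n m * Y k ξ ^ 2))) (fun _ _ => zero_le) (Finset.mem_univ k))
    rw [mul_assoc (2 * expScale n m ψ κ)]
    gcongr
  calc _ ≤ ∫⁻ ξ, ∑ k, ENNReal.ofReal (Real.exp (2 * expScale n m ψ κ *
        numCoords n m * Y k ξ ^ 2)) ∂(trajLaw S) := lintegral_mono hpt
    _ = ∑ k, ∫⁻ ξ, ENNReal.ofReal (Real.exp (2 * expScale n m ψ κ *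
        numCoords n m * Y k ξ ^ 2)) ∂(trajLaw S) := by
      refine lintegral_finsetSum' _ fun k _ => ?_
      exact ((((hlaw k).aemeasurable.pow_const 2).const_mul _).exp).ennreal_ofReal
    _ ≤ ∑ k : (Fin n ⊕ Fin m) ⊕ Fin n, 2 := Finset.sum_le_sum fun k _ => hk k
    _ = _ := by
      rw [Finset.sum_const, Finset.card_univ, hcard, nsmul_eq_mul, mul_comm,
        ENNReal.ofReal_mul (by norm_num), ENNReal.ofReal_natCast, ENNReal.ofReal_ofNat]

end Constants

/-! ### Independence of a fresh sample from the past. -/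

section Sampling

variable {X Y : Type*} [MeasurableSpace X] [MeasurableSpace Y]

/-- A statistic of the first `i` samples is independent of sample number `i`. -/
lemma map_statistic_prodMk_eval (P : Measure X) [IsProbabilityMeasure P] {i : ℕ}
    {f : (ℕ → X) → Y} (hf : Measurable f) (hdep : ∀ s s', (∀ j < i, s j = s' j) → f s = f s') :
    (Measure.infinitePi fun _ : ℕ => P).map (fun s => (f s, s i)) =
      ((Measure.infinitePi fun _ : ℕ => P).map f).prod P := by
  obtain ⟨x₀⟩ : Nonempty X := P.nonempty_of_neZero
  have hind : iIndepFun (fun (j : ℕ) (s : ℕ → X) => s j) (Measure.infinitePi fun _ : ℕ => P) :=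
    iIndepFun_infinitePi (P := fun _ : ℕ => P) (X := fun _ x => x) fun _ => measurable_id
  have h1 := hind.indepFun_finset (Finset.range i) {i} (by simp) fun j => measurable_pi_apply j
  -- The statistic factors through the first i samples: the remaining ones may be padded with an
  -- arbitrary x₀.
  let e : (Finset.range i → X) → ℕ → X := fun t j =>
    if hj : j ∈ Finset.range i then t ⟨j, hj⟩ else x₀
  have he : Measurable e := by
    refine measurable_pi_lambda _ fun j => ?_
    by_cases hj : j ∈ Finset.range i
    · simp only [e, hj, dif_pos]; fun_prop
    · simp only [e, hj, dif_neg, not_false_eq_true]; fun_prop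
  have h2 : IndepFun f (fun s => s i) (Measure.infinitePi fun _ : ℕ => P) := by
    have hev : Measurable fun t : ({i} : Finset ℕ) → X => t ⟨i, Finset.mem_singleton_self i⟩ :=
      measurable_pi_apply _
    have h3 := h1.comp (φ := fun t => f (e t)) (hf.comp he) hev
    convert! h3 using 1
    ext s
    refine hdep _ _ fun j hj => ?_
    simp [e, hj]
  rw [h2.map_prod_eq_prod_map_map hf.aemeasurable (measurable_pi_apply i).aemeasurable,
    Measure.infinitePi_map_eval (fun _ : ℕ => P)]

lemma lintegral_statistic_eval (P : Measure X) [IsProbabilityMeasure P] {i : ℕ}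
    {f : (ℕ → X) → Y} (hf : Measurable f) (hdep : ∀ s s', (∀ j < i, s j = s' j) → f s = f s')
    {g : Y × X → ENNReal} (hg : Measurable g) :
    ∫⁻ s, g (f s, s i) ∂(Measure.infinitePi fun _ : ℕ => P) =
      ∫⁻ s, ∫⁻ x, g (f s, x) ∂P ∂(Measure.infinitePi fun _ : ℕ => P) := by
  rw [← lintegral_map (f := g) hg (hf.prodMk (measurable_pi_apply i)),
    map_statistic_prodMk_eval P hf hdep, lintegral_prod _ hg.aemeasurable,
    lintegral_map hg.lintegral_prod_right' hf]

end Sampling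

/-! ### Measurability and locality of the iterates and of the algorithm. -/

section Iteration

variable {n m : ℕ} (S : GaussianSystem n m)

instance : SecondCountableTopology (Sample n m) := inferInstance

instance : OpensMeasurableSpace (Sample n m) := inferInstance

instance : OpensMeasurableSpace (ℕ → Sample n m) := Pi.opensMeasurableSpace

instance : OpensMeasurableSpace (ℕ × ℕ → Sample n m) := Pi.opensMeasurableSpace

lemma continuous_oracle (h : ℕ) (r : ℝ) :
    Continuous fun p : ((ℕ → Param n m) × Param n m) × Sample n m =>
      oracle S p.1.1 h p.1.2 r p.2 := by
  unfold oracle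
  have hc := continuous_empiricalCost S h
  have h1 : Continuous fun p : ((ℕ → Param n m) × Param n m) × Sample n m =>
      empiricalCost S p.1.1 h p.2.1 (p.1.2 + r • (p.2.2 : Param n m)) :=
    hc.comp (f := fun p : ((ℕ → Param n m) × Param n m) × Sample n m =>
      ((p.1.1, p.1.2 + r • (p.2.2 : Param n m)), p.2.1)) (by fun_prop)
  have h2 : Continuous fun p : ((ℕ → Param n m) × Param n m) × Sample n m =>
      empiricalCost S p.1.1 h p.2.1 (p.1.2 - r • (p.2.2 : Param n m)) :=
    hc.comp (f := fun p : ((ℕ → Param n m) × Param n m) × Sample n m =>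
      ((p.1.1, p.1.2 - r • (p.2.2 : Param n m)), p.2.1)) (by fun_prop)
  exact (continuous_const.mul (h1.sub h2)).smul
    (continuous_subtype_val.comp (continuous_snd.comp continuous_snd))

lemma continuous_iterate (h : ℕ) (r η : ℕ → ℝ) (i : ℕ) :
    Continuous fun p : (ℕ → Param n m) × (ℕ → Sample n m) => iterate S p.1 h r η p.2 i := by
  induction i with
  | zero => exact continuous_const
  | succ i ih =>
    simp only [iterate]
    refine ih.sub (Continuous.const_smul ?_ (η (i + 1)))
    exact (continuous_oracle S h (r (i + 1))).comp
      (f := fun p : (ℕ → Param n m) × (ℕ → Sample n m) =>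
        ((p.1, iterate S p.1 h r η p.2 i), p.2 i)) (by fun_prop)

lemma iterate_congr (F : ℕ → Param n m) (h : ℕ) (r η : ℕ → ℝ) {i : ℕ} {s s' : ℕ → Sample n m}
    (hs : ∀ j < i, s j = s' j) : iterate S F h r η s i = iterate S F h r η s' i := by
  induction i with
  | zero => rfl
  | succ i ih =>
    simp only [iterate]
    rw [ih fun j hj => hs j (by omega), hs i (by omega)]

lemma continuous_rhpg (r : ℕ → ℕ → ℝ) (η : ℕ → ℝ) (T h : ℕ) :
    Continuous fun s : ℕ × ℕ → Sample n m => rhpg S r η T s h := by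
  induction h with
  | zero => exact continuous_const
  | succ h ih =>
    simp only [rhpg]
    refine ih.update h ?_
    exact (continuous_iterate S h (r h) η T).comp
      (f := fun s : ℕ × ℕ → Sample n m => (rhpg S r η T s h, fun i => s (h, i))) (by fun_prop)

lemma rhpg_congr (r : ℕ → ℕ → ℝ) (η : ℕ → ℝ) (T : ℕ) {h : ℕ} {s s' : ℕ × ℕ → Sample n m}
    (hs : ∀ j < h, ∀ i, s (j, i) = s' (j, i)) : rhpg S r η T s h = rhpg S r η T s' h := by
  induction h with
  | zero => rfl
  | succ h ih =>
    simp only [rhpg]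
    rw [ih fun j hj => hs j (by omega), funext (hs h (by omega))]

lemma rhpg_apply_of_lt (r : ℕ → ℕ → ℝ) (η : ℕ → ℝ) (T : ℕ) (s : ℕ × ℕ → Sample n m) {t h N : ℕ}
    (ht : t < h) (hN : h ≤ N) : rhpg S r η T s N t = rhpg S r η T s h t := by
  induction N, hN using Nat.le_induction with
  | base => rfl
  | succ N hN ih => rw [rhpg, Function.update_of_ne (by omega), ih]

lemma rhpg_apply (r : ℕ → ℕ → ℝ) (η : ℕ → ℝ) (T : ℕ) (s : ℕ × ℕ → Sample n m) {h N : ℕ}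
    (hN : h < N) : rhpg S r η T s N h =
      iterate S (rhpg S r η T s h) h (r h) η (fun i => s (h, i)) T := by
  rw [rhpg_apply_of_lt S r η T s (Nat.lt_succ_self h) hN, rhpg, Function.update_self]

lemma measurable_cost (h : ℕ) :
    Measurable fun p : (ℕ → Param n m) × Param n m => cost S p.1 h p.2 :=
  ((continuous_empiricalCost S h).measurable.stronglyMeasurable.integral_prod_right').measurable

end Iteration

/-! ### Choice of stepsize and offset. -/

section Schedule

/-- With θ = 2/(μa), an offset aq forces qη ≤ θ uniformly in q, and s = Bq/x forces qη/s ≤ θ as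
well. Hence (qβ)² ≤ 6θ·qη, and all three requirements hold once a is large, that is, θ small. B =
a(κ+1) places the initial excess risk below B/a. -/
lemma exists_schedule {μ κ C₁ C₃ l : ℝ} (hμ : 0 < μ) (hκ : 0 < κ) (hC₁ : 0 ≤ C₁) (hC₃ : 0 ≤ C₃)
    (hl : 0 < l) : ∃ a > (0 : ℝ), ∃ B > (0 : ℝ), κ ≤ B / a ∧
      ∀ q x η s β : ℝ, 0 < q → a * q ≤ x → η = 2 / μ / (x + 1) → s = B * q / x →
        β = η * (1 + Real.sqrt (2 / s)) →
        2 * q * (C₁ * β) ≤ l ∧ C₃ * (q * β) ^ 2 ≤ q * η * μ ∧ q * η * μ ≤ 1 := by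
  obtain ⟨θ, a, hθ, ha, hθa, ha2, h1, h2⟩ : ∃ θ a : ℝ, 0 < θ ∧ 0 < a ∧ θ * a = 2 / μ ∧ 2 ≤ a ∧
      6 * C₃ * θ ≤ μ ∧ 6 * C₁ * θ ≤ l := by
    have ha : 0 < 2 + 6 * C₃ * (2 / μ) / μ + 6 * C₁ * (2 / μ) / l := by positivity
    have hb : 0 ≤ 6 * C₃ * (2 / μ) / μ := by positivity
    have hc : 0 ≤ 6 * C₁ * (2 / μ) / l := by positivity
    refine ⟨2 / μ / (2 + 6 * C₃ * (2 / μ) / μ + 6 * C₁ * (2 / μ) / l), _, by positivity, ha,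
      div_mul_cancel₀ _ ha.ne', by linarith, ?_, ?_⟩
    · rw [← mul_div_assoc, div_le_iff₀ ha]
      have : μ * (6 * C₃ * (2 / μ) / μ) = 6 * C₃ * (2 / μ) := by field_simp
      nlinarith
    · rw [← mul_div_assoc, div_le_iff₀ ha]
      have : l * (6 * C₁ * (2 / μ) / l) = 6 * C₁ * (2 / μ) := by field_simp
      nlinarith
  refine ⟨a, ha, a * (κ + 1), by positivity, ?_, ?_⟩
  · rw [mul_div_cancel_left₀ _ ha.ne']; linarith
  intro q x η s β hq hx hη hs hβ
  have hx0 : 0 < x := (mul_pos ha hq).trans_le hx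
  have hη0 : 0 < η := by rw [hη]; positivity
  have hs0 : 0 < s := by rw [hs]; positivity
  have hημ : η * (x + 1) = 2 / μ := by rw [hη]; exact div_mul_cancel₀ _ (by positivity)
  have hqη : q * η ≤ θ := by
    have : a * (q * η) ≤ a * θ := by
      calc a * (q * η) = a * q * η := by ring
        _ ≤ (x + 1) * η := by gcongr; linarith
        _ = a * θ := by rw [mul_comm a, hθa, mul_comm, hημ]
    exact le_of_mul_le_mul_left this ha
  have hqs : q * η / s ≤ θ := by
    rw [div_le_iff₀ hs0, hs]
    have : η * x ≤ θ * (a * (κ + 1)) := by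
      rw [← mul_assoc, hθa, ← hημ]
      calc η * x ≤ η * (x + 1) * 1 := by nlinarith
        _ ≤ η * (x + 1) * (κ + 1) := by gcongr; linarith
    rw [← mul_div_assoc, le_div_iff₀ hx0]
    nlinarith
  have hqβ : (q * β) ^ 2 ≤ 6 * θ * (q * η) := by
    have h3 : (1 + Real.sqrt (2 / s)) ^ 2 ≤ 2 + 4 / s := by
      have h4 := Real.sq_sqrt (by positivity : 0 ≤ 2 / s)
      have h5 : 4 / s = 2 * (2 / s) := by ring
      nlinarith [sq_nonneg (1 - Real.sqrt (2 / s))]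
    calc (q * β) ^ 2 = (q * η) ^ 2 * (1 + Real.sqrt (2 / s)) ^ 2 := by rw [hβ]; ring
      _ ≤ (q * η) ^ 2 * (2 + 4 / s) := by gcongr
      _ = (2 * (q * η) + 4 * (q * η / s)) * (q * η) := by ring
      _ ≤ _ := by gcongr; linarith
  have hβ0 : 0 ≤ β := by rw [hβ]; positivity
  refine ⟨?_, ?_, ?_⟩
  · have h3 : q * β ≤ 3 * θ := by
      refine le_of_sq_le_sq ?_ (by positivity)
      nlinarith
    nlinarith
  · calc C₃ * (q * β) ^ 2 ≤ C₃ * (6 * θ * (q * η)) := by gcongr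
      _ = 6 * C₃ * θ * (q * η) := by ring
      _ ≤ μ * (q * η) := by gcongr
      _ = _ := by ring
  · calc q * η * μ ≤ θ * μ := by gcongr
      _ ≤ 1 := by
        have : θ * 2 ≤ 2 / μ := by rw [← hθa]; gcongr
        rw [le_div_iff₀ hμ] at this
        linarith

/-- Since q ≥ 2, the floor term returns at most a quarter of the contraction 2q/(x+1). What is left
exceeds q/(x+1), which suffices by Bernoulli's inequality. -/
lemma decay_step {q : ℕ} (hq : 2 ≤ q) {s x : ℝ} (hs : 0 ≤ s) (hx : 0 < x) :
    (1 - 2 * q / (x + 1)) * s ^ q + 2 * q / (x + 1) * (s / 2) ^ q ≤ (s * (x / (x + 1))) ^ q := by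
  have h1 : (s / 2) ^ q ≤ s ^ q / 4 := by
    have : (4 : ℝ) ≤ 2 ^ q := by
      calc (4 : ℝ) = 2 ^ 2 := by norm_num
        _ ≤ 2 ^ q := pow_le_pow_right₀ (by norm_num) hq
    rw [div_pow]
    gcongr
  have h2 : 1 + (q : ℝ) * (-1 / (x + 1)) ≤ (1 + -1 / (x + 1)) ^ q := by
    refine one_add_mul_le_pow ?_ q
    rw [le_div_iff₀ (by positivity)]
    linarith
  have h3 : x / (x + 1) = 1 + -1 / (x + 1) := by field_simp; ring
  have hsq := pow_nonneg hs q
  have ha : (0 : ℝ) ≤ 2 * q / (x + 1) := by positivity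
  rw [mul_pow, h3]
  have h4 := mul_le_mul_of_nonneg_left h2 hsq
  have h5 := mul_le_mul_of_nonneg_left h1 ha
  have h6 : (q : ℝ) * (-1 / (x + 1)) = -(2 * q / (x + 1)) / 2 := by ring
  rw [h6] at h4
  nlinarith [mul_nonneg ha hsq]

end Schedule

/-! ### High-order moments and failure probability of a single stage. -/

section Convergence

variable {n m : ℕ} [NeZero n] {S : GaussianSystem n m} {F : ℕ → Param n m} {h : ℕ} {μ ψ κ : ℝ}

/-- The constant in front of the second-order term of the moment recursion. -/
noncomputable def secondOrderConst (n m : ℕ) (μ ψ κ : ℝ) : ℝ :=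
  10 * (Regression.noiseConst (n * (m + n)) μ ψ κ / expScale n m ψ κ) ^ 2 * (2 * numCoords n m)

lemma expScale_pos (hψ : 0 < ψ) (hκ : 0 < κ) : 0 < expScale n m ψ κ := by
  have : (0 : ℝ) < numCoords n m := by
    have := NeZero.pos n
    unfold numCoords
    exact_mod_cast (by omega : 0 < n + m + n)
  unfold expScale
  positivity

lemma lintegral_iterate_le (hμ : 0 < μ) (hψ : 0 < ψ) (hκ : 0 < κ)
    {L₀ : Param n m} (hc : (regression S F h).Controlled μ ψ κ L₀)
    (hκ₀ : (regression S F h).gram L₀ L₀ ≤ κ) (H : HasConstants S F h μ ψ κ)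
    {a B : ℝ} (ha : 0 < a) (hB : 0 < B) (hκB : κ ≤ B / a)
    (hsched : ∀ q x η s β : ℝ, 0 < q → a * q ≤ x → η = 2 / μ / (x + 1) → s = B * q / x →
        β = η * (1 + Real.sqrt (2 / s)) →
        2 * q * (Regression.noiseConst (n * (m + n)) μ ψ κ * β) ≤ expScale n m ψ κ ∧
        secondOrderConst n m μ ψ κ * (q * β) ^ 2 ≤ q * η * μ ∧ q * η * μ ≤ 1)
    {r : ℕ → ℝ} (hr : ∀ i, 1 ≤ i → r i ≠ 0) (p : ℕ) (i : ℕ) :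
    ∫⁻ s, ENNReal.ofReal ((regression S F h).gram
        (iterate S F h r (fun i => 2 / μ / ((i : ℝ) + a * (p + 2))) s i - L₀)
        (iterate S F h r (fun i => 2 / μ / ((i : ℝ) + a * (p + 2))) s i - L₀) ^ (p + 2))
        ∂(Measure.infinitePi fun _ : ℕ => sampleLaw S) ≤
      ENNReal.ofReal ((B * (p + 2) / (i + a * (p + 2))) ^ (p + 2)) := by
  set R := regression S F h with hR
  set η : ℕ → ℝ := fun i => 2 / μ / ((i : ℝ) + a * (p + 2)) with hη
  have hp : (0 : ℝ) < (p : ℝ) + 2 := by positivity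
  induction i with
  | zero =>
    simp only [iterate, zero_sub, map_neg, LinearMap.neg_apply, neg_neg, lintegral_const,
      measure_univ, mul_one, Nat.cast_zero, zero_add]
    refine ENNReal.ofReal_le_ofReal (pow_le_pow_left₀ (R.gram_self_nonneg _) ?_ _)
    rw [mul_div_mul_right _ _ hp.ne']
    exact hκ₀.trans hκB
  | succ i ih =>
    set x : ℝ := i + a * (p + 2) with hx
    have hxa : a * (p + 2) ≤ x := by rw [hx]; linarith [(Nat.cast_nonneg i : (0 : ℝ) ≤ i)]
    have hx0 : 0 < x := (mul_pos ha hp).trans_le hxa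
    set s : ℝ := B * (p + 2) / x with hs
    have hs0 : 0 < s := by positivity
    -- Updates are numbered from 1, so the step that leaves iterate i has denominator x + 1.
    have hηi : η (i + 1) = 2 / μ / (x + 1) := by
      simp only [hη, hx]; push_cast; ring_nf
    have hη0 : 0 < η (i + 1) := by rw [hηi]; positivity
    obtain ⟨h1, h2, h3⟩ := hsched (p + 2) x (η (i + 1)) s _ hp hxa hηi hs rfl
    set b : ℝ := (p + 2) * η (i + 1) * μ with hb
    have hb0 : 0 ≤ b := by positivity
    have hstep (L : Param n m) : ∫⁻ z, ENNReal.ofReal (R.gram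
        (L - η (i + 1) • oracle S F h L (r (i + 1)) z - L₀)
        (L - η (i + 1) • oracle S F h L (r (i + 1)) z - L₀) ^ (p + 2)) ∂(sampleLaw S) ≤
        ENNReal.ofReal (1 - b) * ENNReal.ofReal (R.gram (L - L₀) (L - L₀) ^ (p + 2)) +
          ENNReal.ofReal (b * (s / 2) ^ (p + 2)) := by
      have hv := R.gram_self_nonneg (L - L₀)
      simp only [oracle_eq S F h (hr (i + 1) (by omega)), ← hR]
      refine (R.lintegral_pow_step_le hμ hψ hc (map_sphereIsometry_sphereLaw n m)
        (expScale_pos hψ hκ) (by positivity : (0 : ℝ) ≤ 2 * numCoords n m)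
        (H.lintegral_exp_envelope_le hμ hψ hκ) L p hη0 hs0 rfl ?_).trans ?_
      · rw [finrank_param]; exact h1
      · rw [finrank_param, ← secondOrderConst, ← ENNReal.ofReal_mul (by linarith),
          ← ENNReal.ofReal_add (mul_nonneg (by linarith) (pow_nonneg hv _)) (by positivity)]
        refine ENNReal.ofReal_le_ofReal ?_
        set v := R.gram (L - L₀) (L - L₀)
        -- Half of the drift 2b pays for the noise proportional to v; the floor leaves the additive
        -- term b(s/2)^(p+2).
        have hmax : max v (s / 2) ^ (p + 2) ≤ v ^ (p + 2) + (s / 2) ^ (p + 2) := by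
          rcases max_cases v (s / 2) with ⟨h, -⟩ | ⟨h, -⟩ <;> rw [h]
          · linarith [pow_nonneg (half_pos hs0).le (p + 2)]
          · linarith [pow_nonneg hv (p + 2)]
        have h4 := mul_le_mul_of_nonneg_right h2
          (pow_nonneg (hv.trans (le_max_left v (s / 2))) (p + 2))
        have h5 := mul_le_mul_of_nonneg_left hmax hb0
        have h6 : 2 * ((p : ℝ) + 2) * η (i + 1) * μ = 2 * b := by rw [hb]; ring
        rw [h6]
        linarith
    have hcont : Continuous fun L : Param n m => R.gram L L := by
      simp only [← Regression.inner_gramOp]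
      exact (LinearMap.continuous_of_finiteDimensional R.gramOp).inner continuous_id
    have hL : Continuous fun s => iterate S F h r η s i :=
      (continuous_iterate S h r η i).comp (continuous_const.prodMk continuous_id)
    have hg : Measurable fun z : Param n m × Sample n m => ENNReal.ofReal (R.gram
        (z.1 - η (i + 1) • oracle S F h z.1 (r (i + 1)) z.2 - L₀)
        (z.1 - η (i + 1) • oracle S F h z.1 (r (i + 1)) z.2 - L₀) ^ (p + 2)) := by
      have h7 : Continuous fun z : Param n m × Sample n m => oracle S F h z.1 (r (i + 1)) z.2 :=
        (continuous_oracle S h (r (i + 1))).comp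
          (f := fun z : Param n m × Sample n m => ((F, z.1), z.2)) (by fun_prop)
      have h8 : Continuous fun z : Param n m × Sample n m =>
          z.1 - η (i + 1) • oracle S F h z.1 (r (i + 1)) z.2 - L₀ := by fun_prop
      exact ((hcont.comp h8).pow _).measurable.ennreal_ofReal
    have hV : Measurable fun s => ENNReal.ofReal (R.gram (iterate S F h r η s i - L₀)
        (iterate S F h r η s i - L₀) ^ (p + 2)) :=
      ((hcont.comp (hL.sub continuous_const)).pow _).measurable.ennreal_ofReal
    simp only [iterate]
    -- Iterate i uses only samples with index below i, so sample i is fresh and can be integrated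
    -- first.
    rw [lintegral_statistic_eval (sampleLaw S) hL.measurable
      (fun s s' hs => iterate_congr S F h r η hs) hg]
    calc _ ≤ ∫⁻ s', (ENNReal.ofReal (1 - b) * ENNReal.ofReal (R.gram (iterate S F h r η s' i - L₀)
          (iterate S F h r η s' i - L₀) ^ (p + 2)) + ENNReal.ofReal (b * (s / 2) ^ (p + 2)))
          ∂(Measure.infinitePi fun _ : ℕ => sampleLaw S) := lintegral_mono fun s' => hstep _
      _ = ENNReal.ofReal (1 - b) * ∫⁻ s', ENNReal.ofReal (R.gram (iterate S F h r η s' i - L₀)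
          (iterate S F h r η s' i - L₀) ^ (p + 2)) ∂(Measure.infinitePi fun _ : ℕ => sampleLaw S) +
          ENNReal.ofReal (b * (s / 2) ^ (p + 2)) := by
        rw [lintegral_add_right _ measurable_const, lintegral_const_mul _ hV, lintegral_const,
          measure_univ, mul_one]
      _ ≤ ENNReal.ofReal (1 - b) * ENNReal.ofReal (s ^ (p + 2)) +
          ENNReal.ofReal (b * (s / 2) ^ (p + 2)) := by gcongr
      _ ≤ _ := by
        rw [← ENNReal.ofReal_mul (by linarith),
          ← ENNReal.ofReal_add (mul_nonneg (by linarith) (by positivity)) (by positivity)]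
        refine ENNReal.ofReal_le_ofReal ?_
        have h9 := decay_step (q := p + 2) (by omega) hs0.le hx0
        have h10 : b = 2 * ((p + 2 : ℕ) : ℝ) / (x + 1) := by
          rw [hb, hηi]; push_cast; field_simp
        have h11 : B * (p + 2) / (((i + 1 : ℕ) : ℝ) + a * (p + 2)) = s * (x / (x + 1)) := by
          rw [hs, hx]; push_cast; field_simp; ring
        rw [h10, h11]
        exact h9

/-- The set of parameters whose cost exceeds the infimum of the cost by more than `θ`. -/
def suboptimal (S : GaussianSystem n m) (h : ℕ) (θ : ℝ) : Set ((ℕ → Param n m) × Param n m) :=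
  {p | ∃ k, cost S p.1 h (TopologicalSpace.denseSeq (Param n m) k) + θ < cost S p.1 h p.2}

-- Near-optimality quantifies over minimizers and is not evidently measurable in (F, L). Comparison
-- with countably many competitors is.
omit [NeZero n] in
lemma measurableSet_suboptimal (S : GaussianSystem n m) (h : ℕ) (θ : ℝ) :
    MeasurableSet (suboptimal S h θ) := by
  have : suboptimal S h θ = ⋃ k, {p : (ℕ → Param n m) × Param n m |
      cost S p.1 h (TopologicalSpace.denseSeq (Param n m) k) + θ < cost S p.1 h p.2} := by
    ext p; simp [suboptimal]
  rw [this]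
  refine MeasurableSet.iUnion fun k => measurableSet_lt ?_ (measurable_cost S h)
  exact ((measurable_cost S h).comp (measurable_fst.prodMk measurable_const)).add_const θ

-- The growth inequality is strict for such L, and continuity of the cost lets a point of the dense
-- sequence stand in for the minimizer.
omit [NeZero n] in
lemma HasConstants.mem_suboptimal (H : HasConstants S F h μ ψ κ) (hμ : 0 < μ) {ε : ℝ} (hε : 0 < ε)
    {L : Param n m} (hL : ¬ NearOptimal S F h ε L) : (F, L) ∈ suboptimal S h (μ / 2 * ε ^ 2) := by
  obtain ⟨L', hmin, hgr⟩ := H.growth L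
  have h1 : ε < ‖L - L'‖ := by
    by_contra h2
    exact hL ⟨L', hmin, not_lt.1 h2⟩
  have h2 : cost S F h L' < cost S F h L - μ / 2 * ε ^ 2 := by
    have : μ / 2 * ε ^ 2 < μ / 2 * ‖L - L'‖ ^ 2 := by gcongr
    linarith
  obtain ⟨k, hk⟩ := (TopologicalSpace.denseRange_denseSeq (Param n m)).exists_mem_open
    (isOpen_Iio.preimage H.differentiable.continuous) ⟨L', h2⟩
  refine ⟨k, ?_⟩
  have : cost S F h (TopologicalSpace.denseSeq (Param n m) k) < cost S F h L - μ / 2 * ε ^ 2 := hk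
  simp only
  linarith

lemma measure_suboptimal_le (hμ : 0 < μ) (hψ : 0 < ψ) (hκ : 0 < κ) (H : HasConstants S F h μ ψ κ)
    {a B : ℝ} (ha : 0 < a) (hB : 0 < B) (hκB : κ ≤ B / a)
    (hsched : ∀ q x η s β : ℝ, 0 < q → a * q ≤ x → η = 2 / μ / (x + 1) → s = B * q / x →
        β = η * (1 + Real.sqrt (2 / s)) →
        2 * q * (Regression.noiseConst (n * (m + n)) μ ψ κ * β) ≤ expScale n m ψ κ ∧
        secondOrderConst n m μ ψ κ * (q * β) ^ 2 ≤ q * η * μ ∧ q * η * μ ≤ 1)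
    {r : ℕ → ℝ} (hr : ∀ i, 1 ≤ i → r i ≠ 0) {p T : ℕ} {δ ε : ℝ} (hδ : 0 < δ) (hε : 0 < ε)
    (hp : Real.log δ⁻¹ ≤ p) (hT : 2 * Real.exp 1 * B * (p + 2) / (μ * ε ^ 2) ≤ T) :
    (Measure.infinitePi fun _ : ℕ => sampleLaw S)
      {s | (F, iterate S F h r (fun i => 2 / μ / ((i : ℝ) + a * (p + 2))) s T) ∈
        suboptimal S h (μ / 2 * ε ^ 2)} ≤ ENNReal.ofReal δ := by
  obtain ⟨L₀, hc, hκ₀⟩ := H.exists_controlled hμ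
  have hM := lintegral_iterate_le hμ hψ hκ hc hκ₀ H ha hB hκB hsched hr p T
  set R := regression S F h with hR
  set θ := μ / 2 * ε ^ 2 with hθ
  have hθ0 : 0 < θ := by positivity
  set η : ℕ → ℝ := fun i => 2 / μ / ((i : ℝ) + a * (p + 2)) with hη
  have hL : Continuous fun s => iterate S F h r η s T :=
    (continuous_iterate S h r η T).comp (continuous_const.prodMk continuous_id)
  have hcont : Continuous fun L : Param n m => R.gram L L := by
    simp only [← Regression.inner_gramOp]
    exact (LinearMap.continuous_of_finiteDimensional R.gramOp).inner continuous_id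
  have hV : Measurable fun s => ENNReal.ofReal (R.gram (iterate S F h r η s T - L₀)
      (iterate S F h r η s T - L₀) ^ (p + 2)) :=
    ((hcont.comp (hL.sub continuous_const)).pow _).measurable.ennreal_ofReal
  -- Every competitor has risk at least that of L₀, so suboptimality forces the excess risk above θ.
  have hsub : {s | (F, iterate S F h r η s T) ∈ suboptimal S h θ} ⊆
      {s | ENNReal.ofReal (θ ^ (p + 2)) ≤ ENNReal.ofReal (R.gram (iterate S F h r η s T - L₀)
        (iterate S F h r η s T - L₀) ^ (p + 2))} := by
    rintro s ⟨k, hk⟩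
    refine ENNReal.ofReal_le_ofReal (pow_le_pow_left₀ hθ0.le ?_ _)
    have h1 := R.risk_sub_risk hc.corr_eq_zero
    have h2 := h1 (TopologicalSpace.denseSeq (Param n m) k)
    have h3 := R.gram_self_nonneg (TopologicalSpace.denseSeq (Param n m) k - L₀)
    rw [← h1]
    rw [cost_eq, cost_eq, ← hR] at hk
    simp only at hk
    linarith
  refine (measure_mono hsub).trans ?_
  have hmarkov := (mul_meas_ge_le_lintegral hV (ENNReal.ofReal (θ ^ (p + 2)))
    (μ := Measure.infinitePi fun _ : ℕ => sampleLaw S)).trans hM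
  have hθp : 0 < θ ^ (p + 2) := by positivity
  rw [mul_comm, ← ENNReal.le_div_iff_mul_le (.inl (by simpa using hθp)) (.inl ENNReal.ofReal_ne_top),
    ← ENNReal.ofReal_div_of_pos hθp, ← div_pow] at hmarkov
  refine hmarkov.trans (ENNReal.ofReal_le_ofReal ?_)
  have hp0 : (0 : ℝ) < (p : ℝ) + 2 := by positivity
  have hT0 : (0 : ℝ) < T := lt_of_lt_of_le (by positivity) hT
  -- The lower bound on T is chosen to make this ratio at most 1/e; its power p + 2 is then at most
  -- δ because p ≥ log δ⁻¹.
  have h1 : B * (p + 2) / (T + a * (p + 2)) / θ ≤ Real.exp (-1) := by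
    rw [div_div, div_le_iff₀ (by positivity)]
    rw [div_le_iff₀ (by positivity)] at hT
    have h2 : Real.exp (-1) * Real.exp 1 = 1 := by rw [← Real.exp_add]; simp
    have h3 : B * (p + 2) = Real.exp (-1) * (2 * Real.exp 1 * B * (p + 2)) / 2 := by
      calc B * (p + 2) = Real.exp (-1) * Real.exp 1 * (B * (p + 2)) := by rw [h2, one_mul]
        _ = _ := by ring
    have h4 : (T : ℝ) * θ ≤ (T + a * (p + 2)) * θ := by
      gcongr
      linarith [mul_pos ha hp0]
    have h5 : 2 * Real.exp 1 * B * (p + 2) / 2 ≤ (T + a * (p + 2)) * θ := by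
      rw [hθ] at h4 ⊢
      linarith
    calc B * (p + 2) = Real.exp (-1) * (2 * Real.exp 1 * B * (p + 2) / 2) := by rw [h3]; ring
      _ ≤ _ := by gcongr
  calc _ ≤ Real.exp (-1) ^ (p + 2) := pow_le_pow_left₀ (by positivity) h1 _
    _ = Real.exp (-((p : ℝ) + 2)) := by rw [← Real.exp_nat_mul]; push_cast; ring_nf
    _ ≤ Real.exp (Real.log δ) := by
      rw [Real.log_inv] at hp
      exact Real.exp_le_exp.2 (by linarith)
    _ = δ := Real.exp_log hδ

end Convergence

/-! ### Passing from one stage to the whole algorithm. -/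

section AllStages

variable {n m : ℕ}

lemma NearOptimal.congr {S : GaussianSystem n m} {F F' : ℕ → Param n m} {h : ℕ} {ε : ℝ}
    {L : Param n m} (hF : ∀ s < h, F s = F' s) (H : NearOptimal S F h ε L) :
    NearOptimal S F' h ε L := by
  unfold NearOptimal at H ⊢
  rwa [cost_congr S hF] at H

variable [NeZero n] (S : GaussianSystem n m)

lemma map_rhpg_prodMk (r : ℕ → ℕ → ℝ) (η : ℕ → ℝ) (T h : ℕ) :
    (Measure.infinitePi fun _ : ℕ × ℕ => sampleLaw S).map
        (fun s => (rhpg S r η T s h, fun i => s (h, i))) =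
      ((Measure.infinitePi fun _ : ℕ × ℕ => sampleLaw S).map (fun s => rhpg S r η T s h)).prod
        (Measure.infinitePi fun _ : ℕ => sampleLaw S) := by
  -- After currying, all samples of a stage form one coordinate of an i.i.d. sequence, and the
  -- independence statement for single samples applies.
  have hcurry := Measure.infinitePi_map_curry (fun _ _ : ℕ => sampleLaw S)
  have hf : Measurable fun t : ℕ → ℕ → Sample n m =>
      rhpg S r η T ((MeasurableEquiv.curry ℕ ℕ (Sample n m)).symm t) h :=
    (continuous_rhpg S r η T h).measurable.comp (MeasurableEquiv.measurable _)
  have h1 := map_statistic_prodMk_eval (Measure.infinitePi fun _ : ℕ => sampleLaw S) hf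
    (fun s s' hs => rhpg_congr S r η T fun j hj i => congrFun (hs j hj) i)
  rw [← hcurry, Measure.map_map (by fun_prop) (MeasurableEquiv.measurable _),
    Measure.map_map hf (MeasurableEquiv.measurable _)] at h1
  exact h1

/-- Stage `h` of the algorithm is bad with probability at most `δ`, up to earlier parameters for
which a fresh run of that stage is bad with a larger probability. -/
lemma measure_rhpg_le (r : ℕ → ℕ → ℝ) (η : ℕ → ℝ) (T h : ℕ)
    {A : Set ((ℕ → Param n m) × Param n m)} (hA : MeasurableSet A) (δ : ENNReal) :
    (Measure.infinitePi fun _ : ℕ × ℕ => sampleLaw S)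
      {s | (Measure.infinitePi fun _ : ℕ => sampleLaw S)
          {s' | (rhpg S r η T s h, iterate S (rhpg S r η T s h) h (r h) η s' T) ∈ A} ≤ δ ∧
        (rhpg S r η T s h, iterate S (rhpg S r η T s h) h (r h) η (fun i => s (h, i)) T) ∈ A} ≤
      δ := by
  have hA' : MeasurableSet {p : (ℕ → Param n m) × (ℕ → Sample n m) |
      (p.1, iterate S p.1 h (r h) η p.2 T) ∈ A} :=
    (measurable_fst.prodMk (continuous_iterate S h (r h) η T).measurable) hA
  have hφ : Measurable fun F : ℕ → Param n m => (Measure.infinitePi fun _ : ℕ => sampleLaw S)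
      {s' | (F, iterate S F h (r h) η s' T) ∈ A} := measurable_measure_prodMk_left hA'
  -- The first condition is a measurable substitute for validity of the constants, whose
  -- measurability in F is not evident. Every section of D over F has measure at most δ: by that
  -- condition, or because it is empty.
  set D : Set ((ℕ → Param n m) × (ℕ → Sample n m)) :=
    {p | (Measure.infinitePi fun _ : ℕ => sampleLaw S)
      {s' | (p.1, iterate S p.1 h (r h) η s' T) ∈ A} ≤ δ} ∩
      {p | (p.1, iterate S p.1 h (r h) η p.2 T) ∈ A}
  have hD : MeasurableSet D :=
    (measurableSet_le (hφ.comp measurable_fst) measurable_const).inter hA'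
  have hmeas : Measurable fun s : ℕ × ℕ → Sample n m =>
      (rhpg S r η T s h, fun i => s (h, i)) :=
    (continuous_rhpg S r η T h).measurable.prodMk (by fun_prop)
  have hprob : IsProbabilityMeasure ((Measure.infinitePi fun _ : ℕ × ℕ => sampleLaw S).map
      (fun s => rhpg S r η T s h)) :=
    Measure.isProbabilityMeasure_map (continuous_rhpg S r η T h).measurable.aemeasurable
  change (Measure.infinitePi fun _ : ℕ × ℕ => sampleLaw S)
    ((fun s : ℕ × ℕ → Sample n m => (rhpg S r η T s h, fun i => s (h, i))) ⁻¹' D) ≤ δ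
  rw [← Measure.map_apply hmeas hD, map_rhpg_prodMk, Measure.prod_apply hD]
  refine (lintegral_mono fun F => ?_).trans (by rw [lintegral_const, measure_univ, mul_one] :
    ∫⁻ _, δ ∂((Measure.infinitePi fun _ : ℕ × ℕ => sampleLaw S).map
      (fun s => rhpg S r η T s h)) ≤ δ)
  by_cases hF : (Measure.infinitePi fun _ : ℕ => sampleLaw S)
      {s' | (F, iterate S F h (r h) η s' T) ∈ A} ≤ δ
  · exact (measure_mono fun s' hs' => hs'.2).trans hF
  · have : Prod.mk F ⁻¹' D = ∅ := by
      ext s'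
      simp only [mem_preimage, mem_empty_iff_false, iff_false]
      exact fun hs' => hF hs'.1
    simp [this]

end AllStages

/-- The good event G need not be measurable: subadditivity of the outer measure on G ∪ Gᶜ is enough.
-/
lemma one_sub_le_real_of_compl_subset {Ω : Type*} [MeasurableSpace Ω] {P : Measure Ω}
    [IsProbabilityMeasure P] {G B : Set Ω} {δ : ℝ} (hδ : 0 ≤ δ) (hsub : Gᶜ ⊆ B)
    (hB : P B ≤ ENNReal.ofReal δ) : 1 - δ ≤ P.real G := by
  have h1 : P.real Gᶜ ≤ δ := by
    refine ENNReal.toReal_le_of_le_ofReal hδ ((measure_mono hsub).trans hB)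
  have h2 : P.real (G ∪ Gᶜ) ≤ P.real G + P.real Gᶜ := measureReal_union_le G Gᶜ
  rw [union_compl_self, probReal_univ] at h2
  linarith

/-! ### The polylogarithmic sample bound. -/

section Complexity

/-- One power of the logarithm is enough: log δ⁻¹ ≥ 1/2 makes e + f at least e and at least ε⁻¹. -/
lemma softBound_one_ge {K ε δ : ℝ} (hK : 0 ≤ K) (hε : 0 < ε) (hδ : 0 < δ) (hδ' : δ ≤ 1 / 2) :
    K * ((ε ^ 2)⁻¹ * Real.log δ⁻¹) ≤ softBound K 1 ε δ ∧
      K * ((ε ^ 2)⁻¹ * Real.log δ⁻¹) * Real.log ε⁻¹ ≤ softBound K 1 ε δ := by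
  have hlog : 1 / 2 ≤ Real.log δ⁻¹ := by
    have h1 : Real.log 2 ≤ Real.log δ⁻¹ :=
      Real.log_le_log (by norm_num) (by rw [le_inv_comm₀ (by norm_num) hδ]; linarith)
    linarith [Real.log_two_gt_d9]
  have hf : 0 ≤ (ε ^ 2)⁻¹ * Real.log δ⁻¹ := by positivity
  have h2 : ε⁻¹ ≤ Real.exp 1 + (ε ^ 2)⁻¹ * Real.log δ⁻¹ := by
    have h3 : (ε ^ 2)⁻¹ * (1 / 2) ≤ (ε ^ 2)⁻¹ * Real.log δ⁻¹ := by gcongr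
    have h4 := Real.add_one_le_exp (1 : ℝ)
    rw [← inv_pow] at h3 ⊢
    nlinarith [sq_nonneg (ε⁻¹ - 1)]
  have h5 : 1 ≤ Real.log (Real.exp 1 + (ε ^ 2)⁻¹ * Real.log δ⁻¹) := by
    rw [Real.le_log_iff_exp_le (by positivity)]; linarith
  have h6 : Real.log ε⁻¹ ≤ Real.log (Real.exp 1 + (ε ^ 2)⁻¹ * Real.log δ⁻¹) :=
    Real.log_le_log (by positivity) h2
  have hKf := mul_nonneg hK hf
  simp only [softBound, pow_one]
  constructor
  · nlinarith
  · gcongr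

/-- With ℓ = log δ⁻¹ ≥ 1/2, the inner ceiling gives ⌈ℓ⌉ + 2 ≤ ℓ + 3 ≤ 7ℓ, and the 1 from the outer
ceiling is at most 2ε⁻²ℓ. -/
lemma iterations_le {A δ ε : ℝ} (hA : 0 ≤ A) (hε : 0 < ε) (hε' : ε ≤ 1) (hδ : 0 < δ)
    (hδ' : δ ≤ 1 / 2) :
    (⌈A * (⌈Real.log δ⁻¹⌉₊ + 2) / ε ^ 2⌉₊ : ℝ) ≤
      (7 * A + 2) * ((ε ^ 2)⁻¹ * Real.log δ⁻¹) := by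
  have hlog : 1 / 2 ≤ Real.log δ⁻¹ := by
    have h1 : Real.log 2 ≤ Real.log δ⁻¹ :=
      Real.log_le_log (by norm_num) (by rw [le_inv_comm₀ (by norm_num) hδ]; linarith)
    linarith [Real.log_two_gt_d9]
  have h1 : (⌈Real.log δ⁻¹⌉₊ : ℝ) < Real.log δ⁻¹ + 1 := Nat.ceil_lt_add_one (by linarith)
  have h2 := Nat.ceil_lt_add_one (a := A * (⌈Real.log δ⁻¹⌉₊ + 2) / ε ^ 2) (by positivity)
  have h3 : 1 ≤ (ε ^ 2)⁻¹ := (one_le_inv₀ (by positivity)).2 (pow_le_one₀ hε.le hε')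
  have h4 : A * (⌈Real.log δ⁻¹⌉₊ + 2) / ε ^ 2 ≤ 7 * A * ((ε ^ 2)⁻¹ * Real.log δ⁻¹) := by
    rw [div_eq_mul_inv]
    calc _ ≤ A * (7 * Real.log δ⁻¹) * (ε ^ 2)⁻¹ := by gcongr; linarith
      _ = _ := by ring
  nlinarith

end Complexity

end RHPG

/-! ### Assembly of the constants and the union bound. -/

open RHPG in
theorem proposition1 (n m : ℕ) [NeZero n] :
    -- every finite family of subproblems admits valid constants
    (∀ (S : RHPG.GaussianSystem n m) (F : ℕ → RHPG.Param n m) (N : ℕ),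
      ∃ μ ψ κ : ℝ, 0 < μ ∧ 0 < ψ ∧ 0 < κ ∧ ∀ h < N, RHPG.HasConstants S F h μ ψ κ) ∧
    -- convergence with constants that depend only on `n, m, μ, ψ, κ, a`
    (∀ μ ψ κ a : ℝ, 0 < μ → 0 < ψ → 0 < κ → 0 < a →
      ∃ c > (0 : ℝ), ∃ K > (0 : ℝ), ∃ k : ℕ,
        ∀ δ : ℝ, 0 < δ → δ ≤ 1 / 2 → ∃ τ : ℝ, 0 ≤ τ ∧
        ∀ ε : ℝ, 0 < ε → ε ≤ 1 → ∃ T : ℕ,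
          (T : ℝ) ≤ RHPG.softBound K k ε δ ∧
          (∀ N : ℕ, (N : ℝ) ≤ a * (1 + Real.log ε⁻¹) →
            (N : ℝ) * (T : ℝ) ≤ RHPG.softBound K k ε δ) ∧
          ∀ (S : RHPG.GaussianSystem n m) (N : ℕ) (ρ : ℝ) (r : ℕ → ℕ → ℝ),
            (∀ h < N, ∀ i : ℕ, 1 ≤ i → 0 < r h i ∧ r h i ≤ ρ * Real.sqrt ε / (i : ℝ)) →
            -- every single stage, for arbitrary earlier filter parameters
            (∀ h < N, ∀ F : ℕ → RHPG.Param n m, RHPG.HasConstants S F h μ ψ κ →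
              ∀ T' : ℕ, T ≤ T' →
                1 - δ ≤ (Measure.infinitePi fun _ : ℕ => RHPG.sampleLaw S).real
                  {s | RHPG.NearOptimal S F h ε
                    (RHPG.iterate S F h (r h) (fun i => c / ((i : ℝ) + τ)) s T')}) ∧
            -- all stages of the whole algorithm together, with `N * T` oracle calls
            1 - (N : ℝ) * δ ≤ (Measure.infinitePi fun _ : ℕ × ℕ => RHPG.sampleLaw S).real
              {s | ∀ h < N,
                RHPG.HasConstants S (RHPG.rhpg S r (fun i => c / ((i : ℝ) + τ)) T s N) h μ ψ κ →
                RHPG.NearOptimal S (RHPG.rhpg S r (fun i => c / ((i : ℝ) + τ)) T s N) h ε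
                  (RHPG.rhpg S r (fun i => c / ((i : ℝ) + τ)) T s N h)}) := by
  refine ⟨exists_hasConstants_lt, fun μ ψ κ a hμ hψ hκ ha => ?_⟩
  obtain ⟨b, hb, B, hB, hκB, hsched⟩ := exists_schedule
    (C₁ := Regression.noiseConst (n * (m + n)) μ ψ κ) (C₃ := secondOrderConst n m μ ψ κ)
    hμ hκ (Regression.noiseConst_nonneg _ _ _ _) (by unfold secondOrderConst; positivity)
    (expScale_pos (n := n) (m := m) hψ hκ)
  set A : ℝ := 2 * Real.exp 1 * B / μ with hA
  have hA0 : 0 < A := by positivity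
  -- The moment order is ⌈log δ⁻¹⌉ + 2 and the offset is b times it, free of ε. In K, the factor 1 +
  -- 2a covers both T and the total N·T, where 1 + log ε⁻¹ costs two soft bounds.
  refine ⟨2 / μ, by positivity, (7 * A + 2) * (1 + 2 * a), by positivity, 1,
    fun δ hδ hδ' => ⟨b * (⌈Real.log δ⁻¹⌉₊ + 2), by positivity, fun ε hε hε' =>
    ⟨⌈A * (⌈Real.log δ⁻¹⌉₊ + 2) / ε ^ 2⌉₊, ?_, ?_, ?_⟩⟩⟩
  · have h1 := iterations_le hA0.le hε hε' hδ hδ'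
    have h2 := (softBound_one_ge (K := (7 * A + 2) * (1 + 2 * a)) (by positivity) hε hδ hδ').1
    have h3 := (Nat.cast_nonneg _).trans h1
    nlinarith
  · intro N hN
    have h1 := iterations_le hA0.le hε hε' hδ hδ'
    obtain ⟨h2, h3⟩ := softBound_one_ge (K := (7 * A + 2)) (by positivity) hε hδ hδ'
    have h4 : softBound ((7 * A + 2) * (1 + 2 * a)) 1 ε δ =
        (1 + 2 * a) * softBound (7 * A + 2) 1 ε δ := by
      unfold softBound; ring
    have h5 := (Nat.cast_nonneg _).trans h1
    have h6 : 0 ≤ a * (1 + Real.log ε⁻¹) := (Nat.cast_nonneg N).trans hN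
    calc _ ≤ a * (1 + Real.log ε⁻¹) * ((7 * A + 2) * ((ε ^ 2)⁻¹ * Real.log δ⁻¹)) := by gcongr
      _ = a * ((7 * A + 2) * ((ε ^ 2)⁻¹ * Real.log δ⁻¹) +
          (7 * A + 2) * ((ε ^ 2)⁻¹ * Real.log δ⁻¹) * Real.log ε⁻¹) := by ring
      _ ≤ a * (softBound (7 * A + 2) 1 ε δ + softBound (7 * A + 2) 1 ε δ) := by gcongr
      _ ≤ _ := by rw [h4]; nlinarith [h5.trans h2]
  · intro S N ρ r hr
    have hp := Nat.le_ceil (Real.log δ⁻¹)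
    have hTle : 2 * Real.exp 1 * B * (⌈Real.log δ⁻¹⌉₊ + 2) / (μ * ε ^ 2) ≤
        (⌈A * (⌈Real.log δ⁻¹⌉₊ + 2) / ε ^ 2⌉₊ : ℝ) := by
      refine le_trans (le_of_eq ?_) (Nat.le_ceil _)
      rw [hA]; field_simp
    have hstage (h : ℕ) (hh : h < N) (F : ℕ → Param n m) (H : HasConstants S F h μ ψ κ) (T' : ℕ)
        (hT' : ⌈A * (⌈Real.log δ⁻¹⌉₊ + 2) / ε ^ 2⌉₊ ≤ T') :=
      measure_suboptimal_le hμ hψ hκ H hb hB hκB hsched (r := r h)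
        (fun i hi => (hr h hh i hi).1.ne') hδ hε hp (hTle.trans (Nat.cast_le.2 hT'))
    refine ⟨fun h hh F H T' hT' => ?_, ?_⟩
    · exact one_sub_le_real_of_compl_subset hδ.le
        (fun s hs => H.mem_suboptimal hμ hε hs) (hstage h hh F H T' hT')
    · set η : ℕ → ℝ := fun i => 2 / μ / ((i : ℝ) + b * (⌈Real.log δ⁻¹⌉₊ + 2))
      set T := ⌈A * (⌈Real.log δ⁻¹⌉₊ + 2) / ε ^ 2⌉₊
      have hbad (h : ℕ) := measure_rhpg_le S r η T h
        (measurableSet_suboptimal S h (μ / 2 * ε ^ 2)) (ENNReal.ofReal δ)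
      refine one_sub_le_real_of_compl_subset (by positivity) ?_
        ((measure_biUnion_finset_le (Finset.range N) _).trans
          ((Finset.sum_le_sum fun h _ => hbad h).trans ?_))
      · intro s hs
        simp only [mem_compl_iff, mem_ofPred_eq, not_forall] at hs
        obtain ⟨h, hh, H, hnear⟩ := hs
        have hF (t : ℕ) (ht : t < h) : rhpg S r η T s N t = rhpg S r η T s h t :=
          rhpg_apply_of_lt S r η T s ht hh.le
        have H' := H.congr hF
        simp only [mem_iUnion, Finset.mem_range]
        -- Subproblem h sees only the outputs of earlier stages, which later stages leave unchanged.
        -- Valid constants thus put these outputs among those for which a fresh run fails with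
        -- probability at most δ.
        refine ⟨h, hh, hstage h hh _ H' T le_rfl, H'.mem_suboptimal hμ hε fun hn => hnear ?_⟩
        rw [rhpg_apply S r η T s hh]
        exact hn.congr fun t ht => (hF t ht).symm
      · rw [Finset.sum_const, Finset.card_range, nsmul_eq_mul, ENNReal.ofReal_mul (by positivity),
          ENNReal.ofReal_natCast]
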